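/- **Definitions.** A *computable probability space* $(\mathcal X,\mu)$ consists of a computable Polish space $\mathcal X=(X,d,(a_i)_{i\in\mathbb N})$ (a complete metric space $(X,d)$ with a dense sequence $(a_i)$ such that $d(a_i,a_j)$ is computable uniformly in $i,j$) and a Borel probability measure $\mu$ on $X$ such that $\mu(U)$ is lower semicomputable uniformly in a code of the $\Sigma^0_1$ set $U$. Here a $\Sigma^0_1$ set is the union of a c.e. family of balls $B(a_i,r)$, $r\in\mathbb Q_{>0}$, and a code of it is a program enumerating such a family; complements of $\Sigma^0_1$ sets are the $\Pi^0_1$ sets. A function $f\colon X\to\mathbb R$ is computable if preimages of $\Sigma^0_1$ sets of reals are $\Sigma^0_1$, uniformly in codes; a function $g\colon X\to[0,\infty]$ is lower semicomputable if it is the supremum of a computable sequence of computable functions $X\to[0,\infty)$. A *Martin-Löf test* is a computable sequence $(U_n)$ of $\Sigma^0_1$ sets with $\mu(U_n)\le 2^{-n}$; it is a *Schnorr test* if moreover $\mu(U_n)$ is computable uniformly in $n$; it *covers* $x$ if $x\in\bigcap_n U_n$. A *Vitali test* is a computable sequence $(V_n)$ of $\Sigma^0_1$ sets with $\sum_n\mu(V_n)<\infty$;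 it *Vitali covers* $x$ if $x\in V_n$ for infinitely many $n$. A point $x$ is *Martin-Löf random* (*Schnorr random*) if no Martin-Löf test (no Schnorr test) covers it, and *Kurtz random* if it lies in no $\mu$-null $\Pi^0_1$ set. An *a.e. decidable generator* $\mathcal A$ is a sequence of sets $A_i$ given by uniformly computable codes of pairs of disjoint $\Sigma^0_1$ sets $U_i\subseteq A_i\subseteq X\smallsetminus V_i$ with $\mu(U_i\cup V_i)=1$, such that from a code of a $\Sigma^0_1$ set $U$ one can compute a c.e. family of finite Boolean combinations of the $A_i$ whose union equals $U$ up to a $\mu$-null set. Its *cell decomposition* is the family of cells $[\sigma]_{\mathcal A}=\bigcap_{i<|\sigma|}A_i^{\sigma(i)}$, $\sigma\in2^{<\omega}$, where $A_i^0=U_i$ and $A_i^1=V_i$. The *name* of $x$, if it exists, is the unique $z\in2^\omega$ with $x\in[z\upharpoonright n]_{\mathcal A}$ for all $n$; then $x\upharpoonright_{\mathcal A}n:=z\upharpoonright n$. A point without a name is *unrepresented*. A *computable martingale* is a partial function $M\colon2^{<\omega}\to[0,\infty)$, defined at $\sigma$ if and only if $\mu([\sigma]_{\mathcal A})>0$ and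 uniformly computable there, with $M(\sigma0)\mu([\sigma0]_{\mathcal A})+M(\sigma1)\mu([\sigma1]_{\mathcal A})=M(\sigma)\mu([\sigma]_{\mathcal A})$ for all $\sigma$ (where $\mathit{undefined}\cdot 0=0$). A *computable measure* $\nu\colon2^{<\omega}\to[0,\infty)$ is a computable function with $\nu(\sigma0)+\nu(\sigma1)=\nu(\sigma)$ for all $\sigma$. A point $x$ is *computably random with respect to $\mathcal A$* if it is represented, lies in no cell of measure zero, and satisfies none of the following: 1. there is a computable martingale $M$ with $\limsup_n M(x\upharpoonright_{\mathcal A}n)=\infty$; 2. there are a computable martingale $N$ and a partial computable $f\colon2^{<\omega}\to[0,\infty)$, defined at $\sigma$ if and only if $\mu([\sigma]_{\mathcal A})>0$, such that $f(\sigma)\le N(\sigma)\le f(\sigma)+1$ and $f(\sigma)\le f(\tau)$ for $\sigma\preceq\tau$ wherever these are defined, and $\lim_n N(x\upharpoonright_{\mathcal A}n)=\infty$; 3. there are a computable measure $\nu$ and a lower semicomputable $g\colon X\to[0,\infty]$ with $\int_{[\sigma]_{\mathcal A}}g\,d\mu\le\nu(\sigma)$ for all $\sigma$ and $g(x)=\infty$;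 4. there are a computable measure $\nu$ and a Martin-Löf test $(U_n)$ covering $x$ with $\mu(U_n\cap[\sigma]_{\mathcal A})\le2^{-n}\nu(\sigma)$ for all $n,\sigma$; 5. there are a computable measure $\nu$ and a Vitali test $(V_n)$ Vitali covering $x$ with $\sum_n\mu(V_n\cap[\sigma]_{\mathcal A})\le\nu(\sigma)$ for all $\sigma$. **Proposition.** Let $(\mathcal X,\mu)$ be a computable probability space and $x\in\mathcal X$. If $x$ is Martin-Löf random, then $x$ is computably random with respect to every cell decomposition $\mathcal A$ of $(\mathcal X,\mu)$. If $x$ is computably random with respect to some cell decomposition $\mathcal A$ of $(\mathcal X,\mu)$, then $x$ is Schnorr random, and hence Kurtz random. -/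

import Mathlib

open MeasureTheory Filter
open scoped ENNReal

namespace AlgRand

/-! ### Computable reals and effectively open sets -/

/-- The c.e. subset of `α` with program `e`: the set of inputs on which `e` halts. -/
def ceSet (α : Type*) [Primcodable α] (e : Nat.Partrec.Code) : Set α :=
  {b | (e.eval (Encodable.encode b)).Dom}

/-- A family of nonnegative reals `f b` that is computable uniformly in `b`: an algorithm produces,
from `b` and `k`, a (dyadic) rational approximation of `f b` with error at most `2⁻ᵏ`. -/
def ComputableNonneg {α : Type*} [Primcodable α] (f : α → ℝ) : Prop :=
  ∃ g : α → ℕ → ℕ, Computable₂ g ∧ ∀ b k, |f b - (g b k : ℝ) / 2 ^ k| ≤ 1 / 2 ^ k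

/-- The same for a family `f` of nonnegative reals that is only given on `D`: the values `f b` with
`b ∈ D` are computable uniformly in `b` (nothing is asked of the algorithm outside of `D`). -/
def ComputableNonnegOn {α : Type*} [Primcodable α] (D : Set α) (f : α → ℝ) : Prop :=
  ∃ g : α → ℕ →. ℕ, Partrec₂ g ∧
    ∀ b ∈ D, ∀ k, ∃ m ∈ g b k, |f b - (m : ℝ) / 2 ^ k| ≤ 1 / 2 ^ k

/-- The basic open ball with index `(i, p, q)`: its centre is the simple point `a i` and its radius
the positive rational `(p + 1) / (q + 1)`. -/
def basicBall {X : Type*} [MetricSpace X] (a : ℕ → X) (b : ℕ × ℕ × ℕ) : Set X :=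
  Metric.ball (a b.1) (((b.2.1 : ℝ) + 1) / ((b.2.2 : ℝ) + 1))

/-- The `Σ⁰₁` (effectively open) set with code `e`: the union of the basic open balls whose
indices are enumerated by `e`. -/
def sigma1 {X : Type*} [MetricSpace X] (a : ℕ → X) (e : Nat.Partrec.Code) : Set X :=
  ⋃ b ∈ ceSet (ℕ × ℕ × ℕ) e, basicBall a b

/-- A computable sequence of `Σ⁰₁` sets. -/
def IsSigma1Seq {X : Type*} [MetricSpace X] (a : ℕ → X) (U : ℕ → Set X) : Prop :=
  ∃ c : ℕ → Nat.Partrec.Code, Computable c ∧ ∀ n, U n = sigma1 a (c n)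

/-- An enumeration of the rationals, the simple points of the computable Polish space `ℝ`. -/
noncomputable def ratPoint (n : ℕ) : ℝ :=
  ((n.unpair.1.unpair.1 : ℝ) - (n.unpair.1.unpair.2 : ℝ)) / ((n.unpair.2 : ℝ) + 1)

/-- A computable sequence of computable functions `X → ℝ`: preimages of `Σ⁰₁` sets of reals are
`Σ⁰₁`, uniformly in the index of the function and the code of the set. -/
def IsComputableFunSeq {X : Type*} [MetricSpace X] (a : ℕ → X) (f : ℕ → X → ℝ) : Prop :=
  ∃ F : ℕ → Nat.Partrec.Code → Nat.Partrec.Code, Computable₂ F ∧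
    ∀ n e, f n ⁻¹' sigma1 ratPoint e = sigma1 a (F n e)

/-- A function `X → [0, ∞]` is lower semicomputable if it is the supremum of a computable sequence
of computable functions `X → [0, ∞)`. -/
def LowerSemicomputable {X : Type*} [MetricSpace X] (a : ℕ → X) (g : X → ℝ≥0∞) : Prop :=
  ∃ f : ℕ → X → ℝ, IsComputableFunSeq a f ∧ (∀ n x, 0 ≤ f n x) ∧
    ∀ x, g x = ⨆ n, ENNReal.ofReal (f n x)

/-! ### Computable probability spaces -/

/-- `(X, d, a)` is a computable Polish space. -/
structure IsComputablePolish {X : Type*} [MetricSpace X] (a : ℕ → X) : Prop where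
  complete : CompleteSpace X
  dense : DenseRange a
  dist_computable : ComputableNonneg fun p : ℕ × ℕ => dist (a p.1) (a p.2)

/-- `((X, d, a), μ)` is a computable probability space: `μ U` is lower semicomputable uniformly in a
code of the `Σ⁰₁` set `U`, that is, the rationals below it are c.e. uniformly in that code. Only
nonnegative rationals `m / (n + 1)` need to be listed, as the negative ones always lie below. -/
structure IsComputableProbabilitySpace {X : Type*} [MetricSpace X] [MeasurableSpace X]
    (a : ℕ → X) (μ : Measure X) : Prop where
  polish : IsComputablePolish a
  prob : IsProbabilityMeasure μ
  lower_semicomputable : REPred fun p : Nat.Partrec.Code × ℕ × ℕ =>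
    (p.2.1 : ℝ) / ((p.2.2 : ℝ) + 1) < μ.real (sigma1 a p.1)

/-! ### Martin-Löf, Schnorr and Kurtz randomness -/

section Tests

variable {X : Type*} [MetricSpace X] [MeasurableSpace X]

/-- Martin-Löf tests. -/
structure IsMartinLofTest (a : ℕ → X) (μ : Measure X) (U : ℕ → Set X) : Prop where
  sigma1Seq : IsSigma1Seq a U
  measure_le : ∀ n, μ (U n) ≤ (2⁻¹ : ℝ≥0∞) ^ n

/-- Schnorr tests: Martin-Löf tests whose measures are uniformly computable. -/
structure IsSchnorrTest (a : ℕ → X) (μ : Measure X) (U : ℕ → Set X) : Prop where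
  martinLof : IsMartinLofTest a μ U
  computable : ComputableNonneg fun n => μ.real (U n)

/-- Vitali (or Solovay) tests. -/
structure IsVitaliTest (a : ℕ → X) (μ : Measure X) (V : ℕ → Set X) : Prop where
  sigma1Seq : IsSigma1Seq a V
  tsum_lt_top : ∑' n, μ (V n) < ∞

/-- `x` is Martin-Löf random: no Martin-Löf test covers `x`. -/
def MartinLofRandom (a : ℕ → X) (μ : Measure X) (x : X) : Prop :=
  ¬ ∃ U : ℕ → Set X, IsMartinLofTest a μ U ∧ x ∈ ⋂ n, U n

/-- `x` is Schnorr random: no Schnorr test covers `x`. -/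
def SchnorrRandom (a : ℕ → X) (μ : Measure X) (x : X) : Prop :=
  ¬ ∃ U : ℕ → Set X, IsSchnorrTest a μ U ∧ x ∈ ⋂ n, U n

/-- `x` is Kurtz random: `x` lies in no null `Π⁰₁` set. -/
def KurtzRandom (a : ℕ → X) (μ : Measure X) (x : X) : Prop :=
  ¬ ∃ e : Nat.Partrec.Code, μ (sigma1 a e)ᶜ = 0 ∧ x ∈ (sigma1 a e)ᶜ

/-! ### Generators and cell decompositions -/

/-- Finite Boolean combinations of the sets `A i`, in disjunctive normal form: `t` lists conjunctions
of literals, `(i, true)` standing for `A i` and `(i, false)` for its complement. -/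
def boolComb (A : ℕ → Set X) (t : List (List (ℕ × Bool))) : Set X :=
  {x | ∃ c ∈ t, ∀ l ∈ c, (x ∈ A l.1 ↔ l.2 = true)}

/-- An a.e. decidable generator: a uniformly computable sequence of a.e. decidable sets
`A i`, coded by pairs of disjoint `Σ⁰₁` sets `U i ⊆ A i ⊆ X \ V i` with `μ (U i ∪ V i) = 1`, such
that from a code of a `Σ⁰₁` set one can compute (a code of) a c.e. family of finite Boolean
combinations of the `A i` whose union is a.e. equal to the given set. -/
structure Generator (a : ℕ → X) (μ : Measure X) where
  A : ℕ → Set X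
  codeU : ℕ → Nat.Partrec.Code
  codeV : ℕ → Nat.Partrec.Code
  computable_codeU : Computable codeU
  computable_codeV : Computable codeV
  subset : ∀ i, sigma1 a (codeU i) ⊆ A i
  subset_compl : ∀ i, A i ⊆ (sigma1 a (codeV i))ᶜ
  disjoint : ∀ i, sigma1 a (codeU i) ∩ sigma1 a (codeV i) = ∅
  measure_union : ∀ i, μ (sigma1 a (codeU i) ∪ sigma1 a (codeV i)) = 1
  generates : ∃ F : Nat.Partrec.Code → Nat.Partrec.Code, Computable F ∧
    ∀ e, sigma1 a e =ᵐ[μ] ⋃ t ∈ ceSet (List (List (ℕ × Bool))) (F e), boolComb A t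

variable {a : ℕ → X} {μ : Measure X}

/-- The cell `[σ]` of the cell decomposition: the intersection over `i < |σ|` of `U i` (if the digit
`σ i` is `0`) or `V i` (if it is `1`). -/
def Generator.cell (𝒜 : Generator a μ) (σ : List Bool) : Set X :=
  {x | ∀ (i : ℕ) (h : i < σ.length),
    x ∈ if σ[i] = true then sigma1 a (𝒜.codeV i) else sigma1 a (𝒜.codeU i)}

/-- The string formed by the first `n` bits of `z`. -/
def initSeg (z : ℕ → Bool) (n : ℕ) : List Bool := (List.range n).map z

/-- `z` is the name of `x`: for every `n`, the point `x` lies in the cell of the first `n` bits of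
`z`. There is at most one such `z`, since cells of the same length are disjoint. -/
def Generator.IsName (𝒜 : Generator a μ) (x : X) (z : ℕ → Bool) : Prop :=
  ∀ n, x ∈ 𝒜.cell (initSeg z n)

/-- The point `x` has no name. -/
def Generator.Unrepresented (𝒜 : Generator a μ) (x : X) : Prop := ¬ ∃ z, 𝒜.IsName x z

/-- The point `x` lies in a null cell. -/
def Generator.InNullCell (𝒜 : Generator a μ) (x : X) : Prop :=
  ∃ σ, μ (𝒜.cell σ) = 0 ∧ x ∈ 𝒜.cell σ

/-- The strings of the cells of positive measure. -/
def Generator.posCells (𝒜 : Generator a μ) : Set (List Bool) := {σ | 0 < μ.real (𝒜.cell σ)}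

/-! ### Computable randomness with respect to a cell decomposition -/

/-- Computable martingales. A martingale is a partial function `M` to `[0, ∞)` which is defined at
`σ` exactly if `[σ]` has positive measure; it is represented here by a total function whose values
at the other strings are irrelevant (in the fairness condition they are multiplied by `0`). -/
structure Generator.IsComputableMartingale (𝒜 : Generator a μ) (M : List Bool → ℝ) : Prop where
  nonneg : ∀ σ ∈ 𝒜.posCells, 0 ≤ M σ
  fair : ∀ σ, M (σ ++ [false]) * μ.real (𝒜.cell (σ ++ [false])) +
    M (σ ++ [true]) * μ.real (𝒜.cell (σ ++ [true])) = M σ * μ.real (𝒜.cell σ)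
  computable : ComputableNonnegOn 𝒜.posCells M

/-- A computable (finite) measure on Cantor space, given by its values on cylinders. -/
structure IsComputableMeasure (ν : List Bool → ℝ) : Prop where
  nonneg : ∀ σ, 0 ≤ ν σ
  additive : ∀ σ, ν (σ ++ [false]) + ν (σ ++ [true]) = ν σ
  computable : ComputableNonneg ν

/-- Martingale test: a computable martingale succeeds on the name of `x`. -/
def Generator.MartingaleTest (𝒜 : Generator a μ) (x : X) : Prop :=
  ∃ M : List Bool → ℝ, 𝒜.IsComputableMartingale M ∧ ∃ z, 𝒜.IsName x z ∧
    limsup (fun n => (M (initSeg z n) : EReal)) atTop = ⊤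

/-- Martingale test with savings property; the savings function `f` is, like the martingale, a
partial function defined exactly on the strings of cells of positive measure. -/
def Generator.SavingsTest (𝒜 : Generator a μ) (x : X) : Prop :=
  ∃ N f : List Bool → ℝ, 𝒜.IsComputableMartingale N ∧
    ComputableNonnegOn 𝒜.posCells f ∧
    (∀ σ ∈ 𝒜.posCells, 0 ≤ f σ ∧ f σ ≤ N σ ∧ N σ ≤ f σ + 1) ∧
    (∀ σ ∈ 𝒜.posCells, ∀ τ ∈ 𝒜.posCells, σ <+: τ → f σ ≤ f τ) ∧
    ∃ z, 𝒜.IsName x z ∧ Tendsto (fun n => N (initSeg z n)) atTop atTop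

/-- Integral test. -/
def Generator.IntegralTest (𝒜 : Generator a μ) (x : X) : Prop :=
  ∃ (ν : List Bool → ℝ) (g : X → ℝ≥0∞), IsComputableMeasure ν ∧ LowerSemicomputable a g ∧
    (∀ σ, ∫⁻ y in 𝒜.cell σ, g y ∂μ ≤ ENNReal.ofReal (ν σ)) ∧ g x = ∞

/-- Bounded Martin-Löf test. -/
def Generator.BoundedMartinLofTest (𝒜 : Generator a μ) (x : X) : Prop :=
  ∃ (ν : List Bool → ℝ) (U : ℕ → Set X), IsComputableMeasure ν ∧ IsMartinLofTest a μ U ∧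
    (∀ n σ, μ (U n ∩ 𝒜.cell σ) ≤ (2⁻¹ : ℝ≥0∞) ^ n * ENNReal.ofReal (ν σ)) ∧ x ∈ ⋂ n, U n

/-- Vitali cover test. -/
def Generator.VitaliCoverTest (𝒜 : Generator a μ) (x : X) : Prop :=
  ∃ (ν : List Bool → ℝ) (V : ℕ → Set X), IsComputableMeasure ν ∧ IsVitaliTest a μ V ∧
    (∀ σ, ∑' n, μ (V n ∩ 𝒜.cell σ) ≤ ENNReal.ofReal (ν σ)) ∧ {n | x ∈ V n}.Infinite

/-- `x` is computably random with respect to the cell decomposition: it is neither unrepresented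
nor in a null cell, and it satisfies none of the five test conditions. -/
def Generator.ComputablyRandom (𝒜 : Generator a μ) (x : X) : Prop :=
  ¬ 𝒜.Unrepresented x ∧ ¬ 𝒜.InNullCell x ∧
    ¬ (𝒜.MartingaleTest x ∨ 𝒜.SavingsTest x ∨ 𝒜.IntegralTest x ∨ 𝒜.BoundedMartinLofTest x ∨
      𝒜.VitaliCoverTest x)

end Tests

end AlgRand

/-! Martin-Löf randomness implies computable randomness because every way of failing the latter
yields a Martin-Löf test covering `x`, in most cases by a maximal inequality. For an integral test
with total bound below `C`, Markov's inequality bounds the measure of the effectively open set `{g >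
2 ^ n * C}` by `2⁻ⁿ`. For a Vitali test the same is applied to the counting function `∑ n, 1_{V n}`
(`IsVitaliTest.not_martinLofRandom`). For martingales, with or without savings, Ville's inequality
(`Generator.ville`) replaces Markov's. A bounded Martin-Löf test already is a Martin-Löf test, and a
null cell gives a constant one. An unrepresented point is left undecided by some pair `U i`, `V i`,
so it lies in a null effectively closed set.

Conversely, from a Schnorr test `U` covering `x` one obtains a Vitali cover test with `ν σ = ∑ n, μ
(U n ∩ [σ])`. The point is that `ν` is computable. Measures of effectively open sets are
approximable only from below, but the complement of a cell is a.e. equal to the effectively open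
`cocell`. So `ν σ` and its counterpart over the cocell are both approximable from below, and their
sum `∑ n, μ (U n)` is approximable from above (`computableNonneg_of_add_eq`).

A null effectively closed set is likewise turned into a Vitali cover test
(`Generator.vitaliCoverTest_of_null`), which gives Kurtz randomness and disposes of unrepresented
points. Only this step uses that the sets `A i` generate: they supply effectively open sets of
computable measure that dominate the neighbourhoods of `x` up to null sets. -/

namespace AlgRand

/-! ### Computable functions -/

attribute [fun_prop] Computable

section ComputableFunctions

variable {α β γ : Type*} [Primcodable α] [Primcodable β] [Primcodable γ]

@[fun_prop] theorem computable_id : Computable (fun a : α => a) := Computable.id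

@[fun_prop] theorem computable_const (b : β) : Computable (fun _ : α => b) := Computable.const b

@[fun_prop] theorem computable_comp {f : β → γ} {g : α → β} (hf : Computable f)
    (hg : Computable g) : Computable (fun a => f (g a)) := hf.comp hg

@[fun_prop] theorem computable_fst {f : α → β × γ} (hf : Computable f) :
    Computable (fun a => (f a).1) := Computable.fst.comp hf

@[fun_prop] theorem computable_snd {f : α → β × γ} (hf : Computable f) :
    Computable (fun a => (f a).2) := Computable.snd.comp hf

@[fun_prop] theorem computable_pair {f : α → β} {g : α → γ} (hf : Computable f)
    (hg : Computable g) : Computable (fun a => (f a, g a)) := hf.pair hg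

@[fun_prop] theorem computable_add {f g : α → ℕ} (hf : Computable f) (hg : Computable g) :
    Computable (fun a => f a + g a) := Primrec.nat_add.to_comp.comp hf hg

@[fun_prop] theorem computable_mul {f g : α → ℕ} (hf : Computable f) (hg : Computable g) :
    Computable (fun a => f a * g a) := Primrec.nat_mul.to_comp.comp hf hg

@[fun_prop] theorem computable_sub {f g : α → ℕ} (hf : Computable f) (hg : Computable g) :
    Computable (fun a => f a - g a) := Primrec.nat_sub.to_comp.comp hf hg

@[fun_prop] theorem computable_pow {f g : α → ℕ} (hf : Computable f) (hg : Computable g) :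
    Computable (fun a => f a ^ g a) :=
  (Primrec₂.unpaired'.1 Nat.Primrec.pow).to_comp.comp hf hg

@[fun_prop] theorem computable_unpair {f : α → ℕ} (hf : Computable f) :
    Computable (fun a => (f a).unpair) := Computable.unpair.comp hf

@[fun_prop] theorem computable_length {f : α → List β} (hf : Computable f) :
    Computable (fun a => (f a).length) := Computable.list_length.comp hf

@[fun_prop] theorem computable_range {f : α → ℕ} (hf : Computable f) :
    Computable (fun a => List.range (f a)) := Primrec.list_range.to_comp.comp hf

@[fun_prop] theorem computable_getD {f : α → List β} {g : α → ℕ} (d : β) (hf : Computable f)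
    (hg : Computable g) : Computable (fun a => (f a).getD (g a) d) :=
  (Primrec.list_getD d).to_comp.comp hf hg

@[fun_prop] theorem computable_flatten {f : α → List (List β)} (hf : Computable f) :
    Computable (fun a => (f a).flatten) := Primrec.list_flatten.to_comp.comp hf

@[fun_prop] theorem computable_list_sum {f : α → List ℕ} (hf : Computable f) :
    Computable (fun a => (f a).sum) := by
  have h : Primrec (fun l : List ℕ => l.foldr (fun b s => b + s) 0) :=
    Primrec.list_foldr Primrec.id (Primrec.const 0)
      (Primrec.nat_add.comp (Primrec.fst.comp Primrec.snd)
        (Primrec.snd.comp Primrec.snd)).to₂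
  exact h.to_comp.comp hf

@[fun_prop] theorem computable_ite {c : α → Bool} {f g : α → β} (hc : Computable c)
    (hf : Computable f) (hg : Computable g) :
    Computable (fun a => if c a = true then f a else g a) :=
  (Computable.cond hc hf hg).of_eq fun a => by cases c a <;> rfl

@[fun_prop] theorem computable_not {c : α → Bool} (hc : Computable c) :
    Computable (fun a => !(c a)) := Primrec.not.to_comp.comp hc

end ComputableFunctions

/-! ### Recursively enumerable predicates -/

section RecursivelyEnumerable

variable {α β γ : Type*} [Primcodable α] [Primcodable β] [Primcodable γ]

theorem _root_.REPred.comp {p : β → Prop} {f : α → β} (hp : REPred p) (hf : Computable f) :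
    REPred fun a => p (f a) :=
  Partrec.comp hp hf

theorem rePred_ceSet : REPred fun p : Nat.Partrec.Code × α => p.2 ∈ ceSet α p.1 :=
  Partrec.dom_re (Nat.Partrec.Code.eval_part.comp Computable.fst
    (Computable.encode.comp Computable.snd))

theorem exists_ceSet_eq {p : α → Prop} (hp : REPred p) :
    ∃ c : Nat.Partrec.Code, ∀ a, a ∈ ceSet α c ↔ p a := by
  obtain ⟨c, hc⟩ := Nat.Partrec.Code.exists_code.1 hp
  refine ⟨c, fun a => ?_⟩
  simp [ceSet, hc, Part.dom_iff_mem]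

/-- The s-m-n theorem: the parameter is hard-wired into a fixed program by currying. -/
theorem exists_computable_code {p : α × β → Prop} (hp : REPred p) :
    ∃ c : α → Nat.Partrec.Code, Computable c ∧ ∀ a b, b ∈ ceSet β (c a) ↔ p (a, b) := by
  obtain ⟨c, hc⟩ := exists_ceSet_eq hp
  refine ⟨fun a => c.curry (Encodable.encode a),
    Nat.Partrec.Code.primrec₂_curry.to_comp.comp (Computable.const c) Computable.encode, ?_⟩
  intro a b
  rw [← hc]
  simp [ceSet, Nat.Partrec.Code.eval_curry]

/-- `Q n` is halting within the bound `n`. Being decidable, stages can be combined under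
disjunctions and bounded quantifiers; being monotone, finitely many witnesses can be moved to a
common stage. -/
theorem exists_stages {p : α → Prop} (hp : REPred p) :
    ∃ Q : ℕ → α → Prop, PrimrecRel Q ∧ (∀ m n a, m ≤ n → Q m a → Q n a) ∧
      ∀ a, p a ↔ ∃ n, Q n a := by
  obtain ⟨c, hc⟩ := exists_ceSet_eq hp
  refine ⟨fun n a => (c.evaln n (Encodable.encode a)).isSome, ?_, ?_, ?_⟩
  · have : Primrec₂ fun (n : ℕ) (a : α) => (c.evaln n (Encodable.encode a)).isSome :=
      Primrec.option_isSome.comp (Nat.Partrec.Code.primrec_evaln.comp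
        ((Primrec.fst.pair (Primrec.const c)).pair (Primrec.encode.comp Primrec.snd)))
    exact Primrec₂.primrecRel (this.of_eq fun n a => by simp)
  · intro m n a hmn h
    obtain ⟨x, hx⟩ := Option.isSome_iff_exists.1 h
    exact Option.isSome_iff_exists.2 ⟨x, Nat.Partrec.Code.evaln_mono hmn hx⟩
  · intro a
    rw [← hc]
    simp only [ceSet, Set.mem_ofPred_eq, Part.dom_iff_mem, Nat.Partrec.Code.evaln_complete,
      Option.isSome_iff_exists, Option.mem_def]
    exact exists_comm

theorem _root_.REPred.and {p q : α → Prop} (hp : REPred p) (hq : REPred q) :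
    REPred fun a => p a ∧ q a := by
  refine (Partrec.dom_re (Partrec.bind hp (hq.comp Computable.fst).to₂)).of_eq fun a => ?_
  simp [Part.assert, Part.bind]

/-- Dovetailing: an unbounded search runs through pairs of a stage and a candidate witness. -/
theorem _root_.REPred.exists_nat {p : α × ℕ → Prop} (hp : REPred p) : REPred fun a => ∃ n, p (a, n) := by
  obtain ⟨Q, hQ, hmono, hpQ⟩ := exists_stages hp
  classical
  have h : Computable₂ fun (a : α) (n : ℕ) => decide (Q n.unpair.1 (a, n.unpair.2)) :=
    Computable₂.comp (f := fun n x => decide (Q n x)) hQ.decide.to_comp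
      (by fun_prop : Computable fun y : α × ℕ => y.2.unpair.1) (by fun_prop)
  refine (Partrec.dom_re (Partrec.rfind h.partrec₂)).of_eq fun a => ?_
  simp only [Nat.rfind_dom, hpQ]
  constructor
  · rintro ⟨n, hn, -⟩
    exact ⟨_, _, by simpa using hn⟩
  · rintro ⟨n, k, hk⟩
    exact ⟨Nat.pair k n, by simpa using hk, fun _ => trivial⟩

theorem _root_.REPred.exists {p : α × β → Prop} (hp : REPred p) : REPred fun a => ∃ b, p (a, b) := by
  have h : REPred fun x : α × ℕ => ∃ b, Encodable.decode (α := β) x.2 = some b ∧ p (x.1, b) := by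
    have hd : Computable fun x : α × ℕ => Encodable.decode (α := β) x.2 :=
      Computable.decode.comp Computable.snd
    have h1 : Partrec fun x : α × ℕ => ((Encodable.decode (α := β) x.2 : Option β) : Part β).bind
        fun b => Part.assert (p (x.1, b)) fun _ => Part.some () :=
      Partrec.bind hd.ofOption (Partrec.comp hp
        (by fun_prop : Computable fun y : (α × ℕ) × β => (y.1.1, y.2))).to₂
    refine (Partrec.dom_re h1).of_eq fun x => ?_
    cases Encodable.decode (α := β) x.2 <;> simp [Part.assert]
  refine h.exists_nat.of_eq fun a => ⟨?_, ?_⟩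
  · rintro ⟨_, b, _, hb⟩
    exact ⟨b, hb⟩
  · rintro ⟨b, hb⟩
    exact ⟨Encodable.encode b, b, by simp, hb⟩

theorem _root_.REPred.or {p q : α → Prop} (hp : REPred p) (hq : REPred q) :
    REPred fun a => p a ∨ q a := by
  obtain ⟨P, hP, -, hpP⟩ := exists_stages hp
  obtain ⟨Q, hQ, -, hqQ⟩ := exists_stages hq
  have h : REPred fun x : α × ℕ => P x.2 x.1 ∨ Q x.2 x.1 :=
    ((hP.comp Primrec.snd Primrec.fst).or
      (hQ.comp Primrec.snd Primrec.fst)).computablePred.to_re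
  refine h.exists_nat.of_eq fun a => ?_
  simp only [hpP, hqQ]
  exact exists_or

/-- A finite list needs only finitely many stages, so their maximum verifies all entries at once. -/
theorem _root_.REPred.forall_mem {p : α × β → Prop} (hp : REPred p) :
    REPred fun x : α × List β => ∀ b ∈ x.2, p (x.1, b) := by
  obtain ⟨P, hP, hmono, hpP⟩ := exists_stages hp
  have h1 : PrimrecRel fun (b : β) (y : α × ℕ) => P y.2 (y.1, b) :=
    PrimrecRel.comp hP (Primrec.snd.comp Primrec.snd)
      ((Primrec.fst.comp Primrec.snd).pair Primrec.fst)
  have h2 : REPred fun x : (α × List β) × ℕ => ∀ b ∈ x.1.2, P x.2 (x.1.1, b) :=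
    (PrimrecRel.comp h1.forall_mem_list (Primrec.snd.comp Primrec.fst)
      ((Primrec.fst.comp Primrec.fst).pair Primrec.snd)).computablePred.to_re
  refine h2.exists_nat.of_eq fun x => ?_
  obtain ⟨a, l⟩ := x
  simp only [hpP]
  constructor
  · rintro ⟨n, hn⟩ b hb
    exact ⟨n, hn b hb⟩
  · intro h
    induction l with
    | nil => exact ⟨0, by simp⟩
    | cons c l ih =>
      obtain ⟨n, hn⟩ := ih fun b hb => h b (List.mem_cons_of_mem _ hb)
      obtain ⟨m, hm⟩ := h c List.mem_cons_self
      refine ⟨max m n, fun b hb => ?_⟩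
      rcases List.mem_cons.1 hb with rfl | hb
      · exact hmono _ _ _ (le_max_left _ _) hm
      · exact hmono _ _ _ (le_max_right _ _) (hn b hb)

theorem rePred_lt {f g : α → ℕ} (hf : Computable f) (hg : Computable g) :
    REPred fun a => f a < g a :=
  (Primrec.nat_lt.computablePred.to_re).comp (hf.pair hg)

theorem rePred_le {f g : α → ℕ} (hf : Computable f) (hg : Computable g) :
    REPred fun a => f a ≤ g a :=
  (Primrec.nat_le.computablePred.to_re).comp (hf.pair hg)

theorem rePred_eq {f g : α → β} (hf : Computable f) (hg : Computable g) :
    REPred fun a => f a = g a :=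
  ((Primrec.eq (α := β)).computablePred.to_re).comp (hf.pair hg)

theorem rePred_mem {f : α →. β} (hf : Partrec f) : REPred fun x : α × β => x.2 ∈ f x.1 := by
  have h : Partrec fun x : α × β => (f x.1).bind
      fun b => Part.assert (b = x.2) fun _ => Part.some () :=
    Partrec.bind (hf.comp Computable.fst)
      (rePred_eq (by fun_prop : Computable fun y : (α × β) × β => y.2)
        (by fun_prop : Computable fun y : (α × β) × β => y.1.2)).to₂
  refine (Partrec.dom_re h).of_eq fun x => ?_
  simp [Part.dom_iff_mem]

/-- Uniformization: pairs of a candidate and a stage are searched and the first verified candidate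
is returned. This turns pure existence proofs into computable sequences and approximations. -/
theorem exists_computable_selection {p : α × β → Prop} (hp : REPred p) (h : ∀ a, ∃ b, p (a, b)) :
    ∃ f : α → β, Computable f ∧ ∀ a, p (a, f a) := by
  obtain ⟨P, hP, -, hpP⟩ := exists_stages hp
  classical
  let F : α → ℕ → Option β := fun a m => (Encodable.decode (α := β) m.unpair.1).bind
    fun b => if decide (P m.unpair.2 (a, b)) = true then some b else none
  have hF : Computable₂ F := by
    refine Computable.option_bind
      (Computable.decode.comp (by fun_prop : Computable fun x : α × ℕ => x.2.unpair.1)) ?_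
    refine computable_ite ?_ (Computable.option_some.comp Computable.snd) (by fun_prop)
    exact Computable₂.comp (f := fun n x => decide (P n x)) hP.decide.to_comp
      (by fun_prop : Computable fun y : (α × ℕ) × β => y.1.2.unpair.2) (by fun_prop)
  have hFp : ∀ a m b, b ∈ F a m → p (a, b) := by
    intro a m b hb
    obtain ⟨c, _, hc⟩ := Option.bind_eq_some_iff.1 hb
    split_ifs at hc with h1
    cases hc
    exact (hpP _).2 ⟨_, of_decide_eq_true h1⟩
  have hdom : ∀ a, (Nat.rfindOpt (F a)).Dom := by
    intro a
    obtain ⟨b, hb⟩ := h a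
    obtain ⟨n, hn⟩ := (hpP _).1 hb
    exact Nat.rfindOpt_dom.2 ⟨Nat.pair (Encodable.encode b) n, b, by simp [F, hn]⟩
  refine ⟨fun a => (Nat.rfindOpt (F a)).get (hdom a),
    (Partrec.rfindOpt hF).of_eq_tot fun a => Part.get_mem _, fun a => ?_⟩
  obtain ⟨n, hn⟩ := Nat.rfindOpt_spec (Part.get_mem (hdom a))
  exact hFp a n _ hn

end RecursivelyEnumerable

/-! ### Comparison of computable reals with rationals -/

section Comparison

variable {β : Type*} [Primcodable β]

theorem exists_two_pow_inv_lt {ε : ℝ} (hε : 0 < ε) : ∃ k : ℕ, 1 / (2 : ℝ) ^ k < ε := by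
  obtain ⟨k, hk⟩ := exists_pow_lt_of_lt_one hε (by norm_num : (1 / 2 : ℝ) < 1)
  exact ⟨k, by simpa using hk⟩

/-- A strict inequality is certified at some precision `k`, at which the approximation satisfies it
even after adding its error bound `2⁻ᵏ`. Clearing denominators makes the certificate a comparison of
naturals. The summand `u / v` leaves room for radii of balls. -/
theorem ComputableNonneg.rePred_lt {f : β → ℝ} (hf : ComputableNonneg f) {u v w z : β → ℕ}
    (hu : Computable u) (hv : Computable v) (hw : Computable w) (hz : Computable z)
    (hv0 : ∀ y, 0 < v y) (hz0 : ∀ y, 0 < z y) :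
    REPred fun y => f y + (u y : ℝ) / v y < (w y : ℝ) / z y := by
  obtain ⟨g, hg, hfg⟩ := hf
  have hg' : Computable fun y : β × ℕ => g y.1 y.2 := hg
  have h : REPred fun y : β × ℕ =>
      (g y.1 y.2 + 1) * (v y.1 * z y.1) + u y.1 * (z y.1 * 2 ^ y.2) < w y.1 * (v y.1 * 2 ^ y.2) :=
    AlgRand.rePred_lt (by fun_prop) (by fun_prop)
  refine h.exists_nat.of_eq fun y => ?_
  have hvr : (0 : ℝ) < v y := by exact_mod_cast hv0 y
  have hzr : (0 : ℝ) < z y := by exact_mod_cast hz0 y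
  have key : ∀ k, (g y k + 1) * (v y * z y) + u y * (z y * 2 ^ k) < w y * (v y * 2 ^ k) ↔
      ((g y k : ℝ) + 1) / 2 ^ k + (u y : ℝ) / v y < (w y : ℝ) / z y := by
    intro k
    have h2 : (0 : ℝ) < 2 ^ k := by positivity
    rw [div_add_div _ _ h2.ne' hvr.ne', div_lt_div_iff₀ (by positivity) hzr]
    rw [← Nat.cast_lt (α := ℝ)]
    push_cast
    constructor <;> intro h <;> nlinarith
  simp only [key]
  constructor
  · rintro ⟨k, hk⟩
    have h1 := (abs_le.1 (hfg y k)).2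
    rw [add_div] at hk
    linarith
  · intro hlt
    obtain ⟨k, hk⟩ := exists_two_pow_inv_lt (half_pos (sub_pos.2 hlt))
    refine ⟨k, ?_⟩
    have h1 := (abs_le.1 (hfg y k)).1
    rw [add_div]
    linarith

theorem ComputableNonneg.rePred_gt {f : β → ℝ} (hf : ComputableNonneg f) {u v w z : β → ℕ}
    (hu : Computable u) (hv : Computable v) (hw : Computable w) (hz : Computable z)
    (hv0 : ∀ y, 0 < v y) (hz0 : ∀ y, 0 < z y) :
    REPred fun y => (w y : ℝ) / z y < f y + (u y : ℝ) / v y := by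
  obtain ⟨g, hg, hfg⟩ := hf
  have hg' : Computable fun y : β × ℕ => g y.1 y.2 := hg
  have h : REPred fun y : β × ℕ => w y.1 * (v y.1 * 2 ^ y.2) + v y.1 * z y.1 <
      g y.1 y.2 * (v y.1 * z y.1) + u y.1 * (z y.1 * 2 ^ y.2) :=
    AlgRand.rePred_lt (by fun_prop) (by fun_prop)
  refine h.exists_nat.of_eq fun y => ?_
  have hvr : (0 : ℝ) < v y := by exact_mod_cast hv0 y
  have hzr : (0 : ℝ) < z y := by exact_mod_cast hz0 y
  have key : ∀ k, w y * (v y * 2 ^ k) + v y * z y < g y k * (v y * z y) + u y * (z y * 2 ^ k) ↔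
      (w y : ℝ) / z y + 1 / 2 ^ k < (g y k : ℝ) / 2 ^ k + (u y : ℝ) / v y := by
    intro k
    have h2 : (0 : ℝ) < 2 ^ k := by positivity
    have h3 : (w y : ℝ) / z y + 1 / 2 ^ k =
        ((w y : ℝ) * (v y * 2 ^ k) + v y * z y) / (v y * z y * 2 ^ k) := by field_simp
    have h4 : (g y k : ℝ) / 2 ^ k + (u y : ℝ) / v y =
        ((g y k : ℝ) * (v y * z y) + u y * (z y * 2 ^ k)) / (v y * z y * 2 ^ k) := by field_simp
    rw [h3, h4, div_lt_div_iff_of_pos_right (by positivity)]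
    exact_mod_cast Iff.rfl
  simp only [key]
  constructor
  · rintro ⟨k, hk⟩
    have h1 := (abs_le.1 (hfg y k)).1
    linarith
  · intro hlt
    obtain ⟨k, hk⟩ := exists_two_pow_inv_lt (half_pos (sub_pos.2 hlt))
    refine ⟨k, ?_⟩
    have h1 := (abs_le.1 (hfg y k)).2
    linarith

theorem ComputableNonneg.comp {γ : Type*} [Primcodable γ] {f : β → ℝ} (hf : ComputableNonneg f)
    {e : γ → β} (he : Computable e) : ComputableNonneg fun y => f (e y) := by
  obtain ⟨g, hg, hfg⟩ := hf
  exact ⟨fun y k => g (e y) k, hg.comp (he.comp Computable.fst) Computable.snd, fun b k => hfg _ k⟩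

end Comparison

/-! ### Uniform families of effectively open sets -/

section Families

variable {X : Type*} [MetricSpace X] {β γ : Type*} [Primcodable β] [Primcodable γ] {a : ℕ → X}

/-- The radius of a basic ball. -/
noncomputable def radius (b : ℕ × ℕ × ℕ) : ℝ := ((b.2.1 : ℝ) + 1) / ((b.2.2 : ℝ) + 1)

theorem mem_basicBall {b : ℕ × ℕ × ℕ} {x : X} :
    x ∈ basicBall a b ↔ dist x (a b.1) < radius b := Iff.rfl

/-- A family of `Σ⁰₁` sets that is uniformly effectively open in its index. -/
def Sigma1Family (a : ℕ → X) (S : β → Set X) : Prop :=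
  ∃ R : β × (ℕ × ℕ × ℕ) → Prop, REPred R ∧
    ∀ y x, x ∈ S y ↔ ∃ b, R (y, b) ∧ x ∈ basicBall a b

theorem mem_sigma1 {e : Nat.Partrec.Code} {x : X} :
    x ∈ sigma1 a e ↔ ∃ b ∈ ceSet (ℕ × ℕ × ℕ) e, x ∈ basicBall a b := by
  simp only [sigma1, Set.mem_iUnion, exists_prop]

theorem isOpen_sigma1 (e : Nat.Partrec.Code) : IsOpen (sigma1 a e) :=
  isOpen_biUnion fun _ _ => Metric.isOpen_ball

theorem Sigma1Family.of_eq {S T : β → Set X} (hS : Sigma1Family a S) (h : ∀ y, S y = T y) :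
    Sigma1Family a T := (funext h : S = T) ▸ hS

theorem sigma1Family_sigma1 {c : β → Nat.Partrec.Code} (hc : Computable c) :
    Sigma1Family a fun y => sigma1 a (c y) :=
  ⟨fun p => p.2 ∈ ceSet _ (c p.1),
    rePred_ceSet.comp ((hc.comp Computable.fst).pair Computable.snd), fun _ _ => mem_sigma1⟩

theorem Sigma1Family.exists_code {S : β → Set X} (hS : Sigma1Family a S) :
    ∃ c : β → Nat.Partrec.Code, Computable c ∧ ∀ y, S y = sigma1 a (c y) := by
  obtain ⟨R, hR, hS⟩ := hS
  obtain ⟨c, hc, hcR⟩ := exists_computable_code hR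
  refine ⟨c, hc, fun y => Set.ext fun x => ?_⟩
  simp only [hS, mem_sigma1, hcR]

theorem Sigma1Family.isOpen {S : β → Set X} (hS : Sigma1Family a S) (y : β) : IsOpen (S y) := by
  obtain ⟨c, -, hc⟩ := hS.exists_code
  exact hc y ▸ isOpen_sigma1 _

theorem Sigma1Family.isSigma1Seq {S : ℕ → Set X} (hS : Sigma1Family a S) : IsSigma1Seq a S :=
  hS.exists_code

theorem IsSigma1Seq.sigma1Family {S : ℕ → Set X} (hS : IsSigma1Seq a S) : Sigma1Family a S := by
  obtain ⟨c, hc, h⟩ := hS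
  exact (sigma1Family_sigma1 hc).of_eq fun n => (h n).symm

theorem Sigma1Family.comp {S : β → Set X} (hS : Sigma1Family a S) {f : γ → β}
    (hf : Computable f) : Sigma1Family a fun y => S (f y) := by
  obtain ⟨R, hR, hS⟩ := hS
  exact ⟨fun p => R (f p.1, p.2), hR.comp (by fun_prop), fun y x => hS _ _⟩

theorem Sigma1Family.exists {S : β × γ → Set X} (hS : Sigma1Family a S) {P : β × γ → Prop}
    (hP : REPred P) : Sigma1Family a fun y => {x | ∃ z, P (y, z) ∧ x ∈ S (y, z)} := by
  obtain ⟨R, hR, hS⟩ := hS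
  refine ⟨fun p => ∃ z, P (p.1, z) ∧ R ((p.1, z), p.2), ?_, fun y x => ?_⟩
  · exact REPred.exists (p := fun q : (β × ℕ × ℕ × ℕ) × γ => P (q.1.1, q.2) ∧ R ((q.1.1, q.2), q.1.2))
      ((hP.comp (by fun_prop)).and (hR.comp (by fun_prop)))
  · simp only [Set.mem_ofPred_eq, hS]
    constructor
    · rintro ⟨z, hz, b, hb, hx⟩
      exact ⟨b, ⟨z, hz, hb⟩, hx⟩
    · rintro ⟨b, ⟨z, hz, hb⟩, hx⟩
      exact ⟨z, hz, b, hb, hx⟩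

theorem Sigma1Family.iUnion {S : β × γ → Set X} (hS : Sigma1Family a S) :
    Sigma1Family a fun y => ⋃ z, S (y, z) :=
  (hS.exists (P := fun _ => 0 ≤ 0) (rePred_le (by fun_prop) (by fun_prop))).of_eq fun y => by
    ext x; simp

theorem Sigma1Family.ite {S T : β → Set X} (hS : Sigma1Family a S) (hT : Sigma1Family a T)
    {c : β → Bool} (hc : Computable c) :
    Sigma1Family a fun y => if c y = true then S y else T y := by
  obtain ⟨R, hR, hS⟩ := hS
  obtain ⟨R', hR', hT⟩ := hT
  refine ⟨fun p => (c p.1 = true ∧ R p) ∨ (c p.1 = false ∧ R' p), ?_, fun y x => ?_⟩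
  · exact ((rePred_eq (by fun_prop) (by fun_prop)).and hR).or
      ((rePred_eq (by fun_prop) (by fun_prop)).and hR')
  · cases h : c y <;> simp [h, hS, hT]

theorem Sigma1Family.union {S T : β → Set X} (hS : Sigma1Family a S) (hT : Sigma1Family a T) :
    Sigma1Family a fun y => S y ∪ T y := by
  obtain ⟨R, hR, hS⟩ := hS
  obtain ⟨R', hR', hT⟩ := hT
  refine ⟨fun p => R p ∨ R' p, hR.or hR', fun y x => ?_⟩
  simp only [Set.mem_union, hS, hT, or_and_right, exists_or]

theorem exists_basicBall_mem (ha : DenseRange a) (x : X) {ε : ℝ} (hε : 0 < ε) :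
    ∃ b, x ∈ basicBall a b ∧ radius b < ε := by
  obtain ⟨q, hq⟩ := exists_nat_one_div_lt hε
  obtain ⟨i, hi⟩ := ha.exists_dist_lt x (by positivity : (0 : ℝ) < 1 / ((q : ℝ) + 1))
  refine ⟨(i, 0, q), ?_, by simpa [radius] using hq⟩
  rw [mem_basicBall]
  simpa [radius] using hi

/-- Formal inclusion of basic balls. -/
def FormallyInside (a : ℕ → X) (b c : ℕ × ℕ × ℕ) : Prop :=
  dist (a b.1) (a c.1) + radius b < radius c

theorem FormallyInside.subset {b c : ℕ × ℕ × ℕ} (h : FormallyInside a b c) :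
    basicBall a b ⊆ basicBall a c := by
  intro x hx
  rw [mem_basicBall] at *
  have := dist_triangle x (a b.1) (a c.1)
  unfold FormallyInside at h
  linarith

/-- The margin is halved because the radius of `b` is spent twice: on the distance from `x` to the
centre of `b`, and in the definition of formal inclusion. -/
theorem formallyInside_of_mem {b c : ℕ × ℕ × ℕ} {x : X} (hb : x ∈ basicBall a b)
    (h : radius b < (radius c - dist x (a c.1)) / 2) : FormallyInside a b c := by
  rw [mem_basicBall] at hb
  have := dist_triangle_left (a b.1) (a c.1) x
  unfold FormallyInside
  linarith

/-- The reason for preferring formal to actual inclusion: it is a strict inequality between a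
computable real and rationals, hence c.e. -/
theorem rePred_formallyInside (ha : IsComputablePolish a) :
    REPred fun p : (ℕ × ℕ × ℕ) × (ℕ × ℕ × ℕ) => FormallyInside a p.1 p.2 := by
  have h := (ha.dist_computable.comp (by fun_prop :
    Computable fun p : (ℕ × ℕ × ℕ) × (ℕ × ℕ × ℕ) => (p.1.1, p.2.1))).rePred_lt
    (u := fun p => p.1.2.1 + 1) (v := fun p => p.1.2.2 + 1) (w := fun p => p.2.2.1 + 1)
    (z := fun p => p.2.2.2 + 1) (by fun_prop) (by fun_prop) (by fun_prop) (by fun_prop)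
    (fun _ => Nat.succ_pos _) (fun _ => Nat.succ_pos _)
  refine h.of_eq fun p => ?_
  simp [FormallyInside, radius]

theorem exists_pos_forall_mem {ι : Type*} {P : ι → ℝ → Prop}
    (hP : ∀ i ε δ, δ ≤ ε → P i ε → P i δ) (l : List ι) (h : ∀ i ∈ l, ∃ ε > 0, P i ε) :
    ∃ ε > 0, ∀ i ∈ l, P i ε := by
  induction l with
  | nil => exact ⟨1, one_pos, by simp⟩
  | cons c l ih =>
    obtain ⟨ε, hε, h1⟩ := ih fun i hi => h i (List.mem_cons_of_mem _ hi)
    obtain ⟨δ, hδ, h2⟩ := h c List.mem_cons_self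
    refine ⟨min ε δ, lt_min hε hδ, fun i hi => ?_⟩
    rcases List.mem_cons.1 hi with rfl | hi
    · exact hP _ _ _ (min_le_right _ _) h2
    · exact hP _ _ _ (min_le_left _ _) (h1 i hi)

/-- The balls to enumerate are those formally inside some ball of each of the finitely many sets.
They exhaust the intersection: a point of it has a positive margin common to all the sets, and by
density it lies in a ball smaller than that margin. -/
theorem Sigma1Family.forall_mem (ha : IsComputablePolish a) {S : β × γ → Set X}
    (hS : Sigma1Family a S) :
    Sigma1Family a fun y : β × List γ => {x | ∀ z ∈ y.2, x ∈ S (y.1, z)} := by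
  obtain ⟨R, hR, hS⟩ := hS
  have hR' : REPred fun r : ((β × ℕ × ℕ × ℕ) × γ) × (ℕ × ℕ × ℕ) => R ((r.1.1.1, r.1.2), r.2) :=
    hR.comp (f := fun r : ((β × ℕ × ℕ × ℕ) × γ) × (ℕ × ℕ × ℕ) => ((r.1.1.1, r.1.2), r.2))
      (by fun_prop)
  have hI : REPred fun r : ((β × ℕ × ℕ × ℕ) × γ) × (ℕ × ℕ × ℕ) =>
      FormallyInside a r.1.1.2 r.2 :=
    (rePred_formallyInside ha).comp
      (f := fun r : ((β × ℕ × ℕ × ℕ) × γ) × (ℕ × ℕ × ℕ) => (r.1.1.2, r.2)) (by fun_prop)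
  have h1 : REPred fun q : (β × ℕ × ℕ × ℕ) × γ =>
      ∃ c, R ((q.1.1, q.2), c) ∧ FormallyInside a q.1.2 c := (hR'.and hI).exists
  have h2 : Computable fun p : (β × List γ) × (ℕ × ℕ × ℕ) => ((p.1.1, p.2), p.1.2) := by fun_prop
  have h3 := h1.forall_mem.comp h2
  refine ⟨fun p => ∀ z ∈ p.1.2, ∃ c, R ((p.1.1, z), c) ∧ FormallyInside a p.2 c, h3, ?_⟩
  · rintro ⟨y, l⟩ x
    simp only [Set.mem_ofPred_eq, hS]
    constructor
    · intro h
      obtain ⟨ε, hε, h2⟩ := exists_pos_forall_mem (P := fun z ε => ∃ c, R ((y, z), c) ∧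
          ε ≤ (radius c - dist x (a c.1)) / 2)
        (fun i ε δ hδ ⟨c, hc, h⟩ => ⟨c, hc, hδ.trans h⟩) l (fun z hz => by
          obtain ⟨c, hc, hx⟩ := h z hz
          exact ⟨_, half_pos (sub_pos.2 (mem_basicBall.1 hx)), c, hc, le_rfl⟩)
      obtain ⟨b, hxb, hb⟩ := exists_basicBall_mem ha.dense x hε
      refine ⟨b, fun z hz => ?_, hxb⟩
      obtain ⟨c, hc, hcε⟩ := h2 z hz
      exact ⟨c, hc, formallyInside_of_mem hxb (hb.trans_le hcε)⟩
    · rintro ⟨b, hb, hx⟩ z hz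
      obtain ⟨c, hc, hbc⟩ := hb z hz
      exact ⟨c, hc, hbc.subset hx⟩

theorem Sigma1Family.inter (ha : IsComputablePolish a) {S T : β → Set X}
    (hS : Sigma1Family a S) (hT : Sigma1Family a T) : Sigma1Family a fun y => S y ∩ T y := by
  have h := ((hS.comp (Computable.fst (β := Bool))).ite (hT.comp (Computable.fst (β := Bool)))
    Computable.snd).forall_mem ha
  refine (h.comp (by fun_prop : Computable fun y : β => (y, [true, false]))).of_eq fun y => ?_
  ext x
  simp [and_comm]

/-- The effectively open ball of radius `r - 1 / (s + 1)` inside the ball with index `b`. -/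
theorem sigma1Family_shrunkBall (ha : IsComputablePolish a) :
    Sigma1Family a fun p : (ℕ × ℕ × ℕ) × ℕ =>
      {x | dist x (a p.1.1) + 1 / ((p.2 : ℝ) + 1) < radius p.1} := by
  -- A ball `b` is enumerated if it lies formally inside the shrunken ball; `u / v` is `radius b + 1
  -- / (s + 1)` over a common denominator.
  have h := (ha.dist_computable.comp (by fun_prop : Computable
    fun p : ((ℕ × ℕ × ℕ) × ℕ) × (ℕ × ℕ × ℕ) => (p.2.1, p.1.1.1))).rePred_lt
    (u := fun p => (p.2.2.1 + 1) * (p.1.2 + 1) + (p.2.2.2 + 1))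
    (v := fun p => (p.2.2.2 + 1) * (p.1.2 + 1)) (w := fun p => p.1.1.2.1 + 1)
    (z := fun p => p.1.1.2.2 + 1) (by fun_prop) (by fun_prop) (by fun_prop) (by fun_prop)
    (fun _ => by positivity) (fun _ => Nat.succ_pos _)
  have h' : REPred fun p : ((ℕ × ℕ × ℕ) × ℕ) × (ℕ × ℕ × ℕ) =>
      dist (a p.2.1) (a p.1.1.1) + (radius p.2 + 1 / ((p.1.2 : ℝ) + 1)) < radius p.1.1 := by
    refine h.of_eq fun p => ?_
    have h1 : radius p.2 + 1 / ((p.1.2 : ℝ) + 1) =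
        (((p.2.2.1 + 1) * (p.1.2 + 1) + (p.2.2.2 + 1) : ℕ) : ℝ) /
          ((p.2.2.2 + 1) * (p.1.2 + 1) : ℕ) := by
      unfold radius
      push_cast
      field_simp
    rw [h1]
    simp [radius]
  refine ⟨_, h', ?_⟩
  rintro ⟨c, s⟩ x
  simp only [Set.mem_ofPred_eq, mem_basicBall]
  constructor
  · intro hx
    obtain ⟨b, hxb, hb⟩ := exists_basicBall_mem ha.dense x (half_pos (sub_pos.2 hx))
    rw [mem_basicBall] at hxb
    refine ⟨b, ?_, hxb⟩
    have := dist_triangle_left (a b.1) (a c.1) x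
    linarith
  · rintro ⟨b, hb, hxb⟩
    have := dist_triangle x (a b.1) (a c.1)
    linarith

/-- The exterior of the ball of radius `r - 1 / (s + 1)` inside the ball with index `b`. -/
theorem sigma1Family_exteriorBall (ha : IsComputablePolish a) :
    Sigma1Family a fun p : (ℕ × ℕ × ℕ) × ℕ =>
      {x | radius p.1 < dist x (a p.1.1) + 1 / ((p.2 : ℝ) + 1)} := by
  have h := (ha.dist_computable.comp (by fun_prop : Computable
    fun p : ((ℕ × ℕ × ℕ) × ℕ) × (ℕ × ℕ × ℕ) => (p.2.1, p.1.1.1))).rePred_gt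
    (w := fun p => (p.1.1.2.1 + 1) * (p.2.2.2 + 1) + (p.2.2.1 + 1) * (p.1.1.2.2 + 1))
    (z := fun p => (p.1.1.2.2 + 1) * (p.2.2.2 + 1)) (u := fun _ => 1)
    (v := fun p => p.1.2 + 1) (by fun_prop) (by fun_prop) (by fun_prop) (by fun_prop)
    (fun _ => Nat.succ_pos _) (fun _ => by positivity)
  have h' : REPred fun p : ((ℕ × ℕ × ℕ) × ℕ) × (ℕ × ℕ × ℕ) =>
      radius p.1.1 + radius p.2 < dist (a p.2.1) (a p.1.1.1) + 1 / ((p.1.2 : ℝ) + 1) := by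
    refine h.of_eq fun p => ?_
    have h1 : radius p.1.1 + radius p.2 =
        (((p.1.1.2.1 + 1) * (p.2.2.2 + 1) + (p.2.2.1 + 1) * (p.1.1.2.2 + 1) : ℕ) : ℝ) /
          ((p.1.1.2.2 + 1) * (p.2.2.2 + 1) : ℕ) := by
      unfold radius
      push_cast
      field_simp
    rw [h1]
    simp
  refine ⟨_, h', ?_⟩
  rintro ⟨c, s⟩ x
  simp only [Set.mem_ofPred_eq, mem_basicBall]
  constructor
  · intro hx
    obtain ⟨b, hxb, hb⟩ := exists_basicBall_mem ha.dense x (half_pos (sub_pos.2 hx))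
    rw [mem_basicBall] at hxb
    refine ⟨b, ?_, hxb⟩
    have := dist_triangle x (a b.1) (a c.1)
    linarith
  · rintro ⟨b, hb, hxb⟩
    have := dist_triangle_left (a b.1) (a c.1) x
    linarith

end Families

/-! ### Semicomputable families of reals -/

section Semicomputable

variable {β : Type*} [Primcodable β]

/-- The dyadic rationals below `f y` are c.e. uniformly in `y`. -/
def LowerApproximable (f : β → ℝ) : Prop :=
  REPred fun p : β × ℕ × ℕ => (p.2.1 : ℝ) / 2 ^ p.2.2 < f p.1

/-- The dyadic rationals above `f y` are c.e. uniformly in `y`. -/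
def UpperApproximable (f : β → ℝ) : Prop :=
  REPred fun p : β × ℕ × ℕ => f p.1 < (p.2.1 : ℝ) / 2 ^ p.2.2

theorem ComputableNonneg.upperApproximable {f : β → ℝ} (hf : ComputableNonneg f) :
    UpperApproximable f := by
  have h := (hf.comp (e := fun p : β × ℕ × ℕ => p.1) (by fun_prop)).rePred_lt (u := fun _ => 0)
    (v := fun _ => 1) (w := fun p => p.2.1) (z := fun p => 2 ^ p.2.2) (by fun_prop) (by fun_prop)
    (by fun_prop) (by fun_prop) (fun _ => one_pos) (fun _ => by positivity)
  exact h.of_eq fun p => by simp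

theorem lowerApproximable_measure {X : Type*} [MetricSpace X] [MeasurableSpace X] {a : ℕ → X}
    {μ : Measure X} (hμ : IsComputableProbabilitySpace a μ) {S : β → Set X}
    (hS : Sigma1Family a S) : LowerApproximable fun y => μ.real (S y) := by
  obtain ⟨c, hc, hcS⟩ := hS.exists_code
  -- Denominators are coded there as `n + 1`, hence `2 ^ k - 1`.
  have h := hμ.lower_semicomputable.comp
    (f := fun p : β × ℕ × ℕ => (c p.1, p.2.1, 2 ^ p.2.2 - 1)) (by fun_prop)
  refine h.of_eq fun p => ?_
  have h1 : 1 ≤ 2 ^ p.2.2 := Nat.one_le_two_pow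
  simp only [hcS]
  push_cast [h1]
  simp

theorem sum_getD (l : List ℕ) : l.sum = ∑ i ∈ Finset.range l.length, l.getD i 0 := by
  induction l with
  | nil => simp
  | cons c l ih => simp [Finset.sum_range_succ', ih, add_comm]

theorem sum_map_range (N : ℕ) (f : ℕ → ℕ) :
    ((List.range N).map f).sum = ∑ i ∈ Finset.range N, f i := by
  induction N with
  | zero => simp
  | succ N ih => simp [List.range_succ, Finset.sum_range_succ, ih]

theorem exists_div_two_pow_lt (N : ℕ) {ε : ℝ} (hε : 0 < ε) : ∃ k : ℕ, (N : ℝ) / 2 ^ k < ε := by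
  obtain ⟨k, hk⟩ := exists_two_pow_inv_lt (by positivity : 0 < ε / (N + 1))
  refine ⟨k, ?_⟩
  have hN : (0 : ℝ) < N + 1 := by positivity
  rw [lt_div_iff₀ hN] at hk
  calc (N : ℝ) / 2 ^ k ≤ 1 / 2 ^ k * (N + 1) := by
        rw [div_eq_mul_one_div, mul_comm]; gcongr; linarith
    _ < ε := hk

/-- A rational lies below the sum iff it lies below the sum of a finite list of rational lower
bounds for the first terms. Zero entries are admitted without a check, since a term may vanish and
then has no strict lower bound among the nonnegative dyadics. -/
theorem LowerApproximable.tsum {f : β × ℕ → ℝ} (hf : LowerApproximable f)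
    (h0 : ∀ y n, 0 ≤ f (y, n)) (hs : ∀ y, Summable fun n => f (y, n)) :
    LowerApproximable fun y => ∑' n, f (y, n) := by
  have h1 : REPred fun q : ((β × ℕ × ℕ) × List ℕ × ℕ) × ℕ => q.1.2.1.getD q.2 0 = 0 ∨
      (q.1.2.1.getD q.2 0 : ℝ) / 2 ^ q.1.2.2 < f (q.1.1.1, q.2) :=
    (rePred_eq (by fun_prop) (by fun_prop)).or (hf.comp
      (f := fun q : ((β × ℕ × ℕ) × List ℕ × ℕ) × ℕ =>
        ((q.1.1.1, q.2), q.1.2.1.getD q.2 0, q.1.2.2)) (by fun_prop))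
  have h2 := h1.forall_mem.comp (f := fun q : (β × ℕ × ℕ) × List ℕ × ℕ =>
    (q, List.range q.2.1.length)) (by fun_prop)
  have h3 : REPred fun q : (β × ℕ × ℕ) × List ℕ × ℕ =>
      q.1.2.1 * 2 ^ q.2.2 < q.2.1.sum * 2 ^ q.1.2.2 := AlgRand.rePred_lt (by fun_prop) (by fun_prop)
  refine (h2.and h3).exists.of_eq ?_
  rintro ⟨y, m, k⟩
  have key : ∀ S k', m * 2 ^ k' < S * 2 ^ k ↔ (m : ℝ) / 2 ^ k < (S : ℝ) / 2 ^ k' := by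
    intro S k'
    rw [div_lt_div_iff₀ (by positivity) (by positivity)]
    exact_mod_cast Iff.rfl
  simp only [Prod.exists, List.mem_range, key]
  constructor
  · rintro ⟨l, k', h, hlt⟩
    refine hlt.trans_le (le_trans ?_ ((hs y).sum_le_tsum (Finset.range l.length)
      fun i _ => h0 y i))
    rw [sum_getD, Nat.cast_sum, Finset.sum_div]
    refine Finset.sum_le_sum fun i hi => ?_
    rcases h i (Finset.mem_range.1 hi) with h | h
    · rw [h]; simpa using h0 y i
    · exact h.le
  · intro hlt
    obtain ⟨N, hN⟩ := ((hs y).hasSum.tendsto_sum_nat.eventually (lt_mem_nhds hlt)).exists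
    obtain ⟨k', hk'⟩ := exists_div_two_pow_lt N (sub_pos.2 hN)
    -- `⌈t⌉₊ - 1` is the largest natural strictly below `t` (or `0`). Each of the `N` terms loses at
    -- most `2⁻ᵏ'` by rounding, which `hk'` keeps below the gap.
    refine ⟨(List.range N).map fun i => ⌈f (y, i) * 2 ^ k'⌉₊ - 1, k', ?_, ?_⟩
    · intro i hi
      have hi : i < N := by simpa using hi
      rcases Nat.eq_zero_or_pos ⌈f (y, i) * 2 ^ k'⌉₊ with h | h
      · left; simp [hi, h]
      · right
        have : ((⌈f (y, i) * 2 ^ k'⌉₊ - 1 : ℕ) : ℝ) < f (y, i) * 2 ^ k' :=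
          Nat.lt_ceil.1 (Nat.sub_lt h one_pos)
        rw [div_lt_iff₀ (by positivity)]
        simpa [hi] using this
    · rw [sum_map_range, lt_div_iff₀ (by positivity)]
      have h4 : ∀ i, f (y, i) * 2 ^ k' ≤ ((⌈f (y, i) * 2 ^ k'⌉₊ - 1 : ℕ) : ℝ) + 1 := by
        intro i
        refine (Nat.le_ceil _).trans ?_
        exact_mod_cast (by omega : ⌈f (y, i) * 2 ^ k'⌉₊ ≤ ⌈f (y, i) * 2 ^ k'⌉₊ - 1 + 1)
      have h5 := Finset.sum_le_sum fun i (_ : i ∈ Finset.range N) => h4 i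
      rw [← Finset.sum_mul, Finset.sum_add_distrib] at h5
      rw [div_lt_iff₀ (by positivity)] at hk'
      push_cast
      simp only [Finset.sum_const, Finset.card_range, nsmul_eq_mul, mul_one] at h5
      nlinarith

/-- Upper bounds on finitely many terms say nothing about an infinite sum without control of the
tail; domination by `(1 / 2) ^ n` bounds the tail after `N` terms by `2 / 2 ^ N`. -/
theorem UpperApproximable.tsum {u : ℕ → ℝ} (hu : UpperApproximable u) (h0 : ∀ n, 0 ≤ u n)
    (hle : ∀ n, u n ≤ (1 / 2) ^ n) : UpperApproximable fun _ : Unit => ∑' n, u n := by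
  have hg : Summable fun n : ℕ => (1 / 2 : ℝ) ^ n := summable_geometric_two
  have hs : Summable u := Summable.of_nonneg_of_le h0 hle hg
  have h1 : REPred fun q : ((Unit × ℕ × ℕ) × List ℕ × ℕ) × ℕ =>
      u q.2 < (q.1.2.1.getD q.2 0 : ℝ) / 2 ^ q.1.2.2 :=
    hu.comp (f := fun q : ((Unit × ℕ × ℕ) × List ℕ × ℕ) × ℕ =>
      (q.2, q.1.2.1.getD q.2 0, q.1.2.2)) (by fun_prop)
  have h2 := h1.forall_mem.comp (f := fun q : (Unit × ℕ × ℕ) × List ℕ × ℕ =>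
    (q, List.range q.2.1.length)) (by fun_prop)
  have h3 : REPred fun q : (Unit × ℕ × ℕ) × List ℕ × ℕ =>
      (q.2.1.sum * 2 ^ q.2.1.length + 2 * 2 ^ q.2.2) * 2 ^ q.1.2.2 <
        q.1.2.1 * (2 ^ q.2.2 * 2 ^ q.2.1.length) := AlgRand.rePred_lt (by fun_prop) (by fun_prop)
  refine (h2.and h3).exists.of_eq ?_
  rintro ⟨y, m, k⟩
  have key : ∀ S N k', (S * 2 ^ N + 2 * 2 ^ k') * 2 ^ k < m * (2 ^ k' * 2 ^ N) ↔
      (S : ℝ) / 2 ^ k' + 2 / 2 ^ N < (m : ℝ) / 2 ^ k := by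
    intro S N k'
    rw [div_add_div _ _ (by positivity) (by positivity),
      div_lt_div_iff₀ (by positivity) (by positivity), mul_comm ((2 : ℝ) ^ k') 2]
    exact_mod_cast Iff.rfl
  have htail : ∀ N, ∑' n, u n ≤ ∑ i ∈ Finset.range N, u i + 2 / 2 ^ N := by
    intro N
    rw [← hs.sum_add_tsum_nat_add N]
    gcongr
    calc ∑' i, u (i + N) ≤ ∑' i : ℕ, (1 / 2 : ℝ) ^ (i + N) :=
          ((summable_nat_add_iff N).2 hs).tsum_le_tsum (fun i => hle _)
            ((summable_nat_add_iff N).2 hg)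
      _ = 2 / 2 ^ N := by
          simp only [pow_add, tsum_mul_right, tsum_geometric_two]
          rw [one_div, inv_pow]; rfl
  simp only [Prod.exists, List.mem_range, key]
  constructor
  · rintro ⟨l, k', h, hlt⟩
    refine (htail l.length).trans_lt (lt_of_le_of_lt ?_ hlt)
    gcongr
    rw [sum_getD, Nat.cast_sum, Finset.sum_div]
    exact Finset.sum_le_sum fun i hi => (h i (Finset.mem_range.1 hi)).le
  · intro hlt
    -- Half of the gap pays for the tail, the other half for rounding up `N` terms.
    obtain ⟨N, hN⟩ := exists_div_two_pow_lt 2 (half_pos (sub_pos.2 hlt))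
    obtain ⟨k', hk'⟩ := exists_div_two_pow_lt N (half_pos (sub_pos.2 hlt))
    refine ⟨(List.range N).map fun i => ⌊u i * 2 ^ k'⌋₊ + 1, k', ?_, ?_⟩
    · intro i hi
      have hi : i < N := by simpa using hi
      have := Nat.lt_floor_add_one (u i * 2 ^ k')
      rw [lt_div_iff₀ (by positivity)]
      simpa [hi] using this
    · rw [sum_map_range, List.length_map, List.length_range]
      have h4 : ∀ i, ((⌊u i * 2 ^ k'⌋₊ + 1 : ℕ) : ℝ) / 2 ^ k' ≤ u i + 1 / 2 ^ k' := by
        intro i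
        have := Nat.floor_le (by have := h0 i; positivity : 0 ≤ u i * 2 ^ k')
        rw [div_le_iff₀ (by positivity), add_mul, one_div, inv_mul_cancel₀ (by positivity)]
        push_cast
        linarith
      have h5 := Finset.sum_le_sum fun i (_ : i ∈ Finset.range N) => h4 i
      rw [Finset.sum_add_distrib, ← Finset.sum_div] at h5
      simp only [Finset.sum_const, Finset.card_range, nsmul_eq_mul] at h5
      have h6 := hs.sum_le_tsum (Finset.range N) fun i _ => h0 i
      rw [mul_one_div] at h5
      push_cast at h5 hN ⊢
      linarith

/-- Since `f = T - f'`, upper bounds for `T` and lower bounds for `f'` give upper bounds for `f`.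
Approximability from both sides then yields computability by searching for a good approximation. -/
theorem computableNonneg_of_add_eq {f f' : β → ℝ} {T : ℝ} (hf : LowerApproximable f)
    (hf' : LowerApproximable f') (hT : UpperApproximable fun _ : Unit => T) (h0 : ∀ y, 0 ≤ f y)
    (h0' : ∀ y, 0 ≤ f' y) (h : ∀ y, f y + f' y = T) : ComputableNonneg f := by
  have hT' : REPred fun q : (β × ℕ × ℕ) × (ℕ × ℕ × ℕ) => T < (q.2.1 : ℝ) / 2 ^ q.2.2.2 :=
    hT.comp (f := fun q : (β × ℕ × ℕ) × (ℕ × ℕ × ℕ) => ((), q.2.1, q.2.2.2)) (by fun_prop)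
  have hl' : REPred fun q : (β × ℕ × ℕ) × (ℕ × ℕ × ℕ) => q.2.2.1 = 0 ∨
      (q.2.2.1 : ℝ) / 2 ^ q.2.2.2 < f' q.1.1 :=
    (rePred_eq (by fun_prop) (by fun_prop)).or (hf'.comp
      (f := fun q : (β × ℕ × ℕ) × (ℕ × ℕ × ℕ) => (q.1.1, q.2.2.1, q.2.2.2)) (by fun_prop))
  have hc : REPred fun q : (β × ℕ × ℕ) × (ℕ × ℕ × ℕ) =>
      q.2.1 * 2 ^ q.1.2.2 ≤ q.1.2.1 * 2 ^ q.2.2.2 + q.2.2.1 * 2 ^ q.1.2.2 :=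
    rePred_le (by fun_prop) (by fun_prop)
  have hup : UpperApproximable f := by
    refine (hT'.and (hl'.and hc)).exists.of_eq ?_
    rintro ⟨y, m, k⟩
    have key : ∀ M n k', M * 2 ^ k ≤ m * 2 ^ k' + n * 2 ^ k ↔
        (M : ℝ) / 2 ^ k' ≤ (m : ℝ) / 2 ^ k + (n : ℝ) / 2 ^ k' := by
      intro M n k'
      rw [div_add_div _ _ (by positivity) (by positivity),
        div_le_div_iff₀ (by positivity) (by positivity), ← mul_assoc, mul_comm _ ((2 : ℝ) ^ k'),
        mul_comm _ ((2 : ℝ) ^ k'), mul_le_mul_iff_right₀ (by positivity),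
        mul_comm ((2 : ℝ) ^ k) (n : ℝ)]
      exact_mod_cast Iff.rfl
    simp only [Prod.exists, key]
    have hy := h y
    constructor
    · rintro ⟨M, n, k', hM, hn, hle⟩
      have : (n : ℝ) / 2 ^ k' ≤ f' y := by
        rcases hn with rfl | hn
        · simpa using h0' y
        · exact hn.le
      linarith
    · intro hlt
      -- One unit of `2⁻ᵏ'` is lost in rounding `T` up and one in rounding `f' y` down.
      obtain ⟨k', hk'⟩ := exists_div_two_pow_lt 2 (sub_pos.2 hlt)
      have hT0 : 0 ≤ T := by linarith [h0 y, h0' y]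
      refine ⟨⌊T * 2 ^ k'⌋₊ + 1, ⌈f' y * 2 ^ k'⌉₊ - 1, k', ?_, ?_, ?_⟩
      · rw [lt_div_iff₀ (by positivity)]
        exact_mod_cast Nat.lt_floor_add_one (T * 2 ^ k')
      · rcases Nat.eq_zero_or_pos ⌈f' y * 2 ^ k'⌉₊ with h | h
        · left; simp [h]
        · right
          rw [div_lt_iff₀ (by positivity)]
          exact Nat.lt_ceil.1 (Nat.sub_lt h one_pos)
      · have h1 : ((⌊T * 2 ^ k'⌋₊ + 1 : ℕ) : ℝ) / 2 ^ k' ≤ T + 1 / 2 ^ k' := by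
          have := Nat.floor_le (by positivity : 0 ≤ T * 2 ^ k')
          rw [div_le_iff₀ (by positivity), add_mul, one_div, inv_mul_cancel₀ (by positivity)]
          push_cast
          linarith
        have h2 : f' y ≤ ((⌈f' y * 2 ^ k'⌉₊ - 1 : ℕ) : ℝ) / 2 ^ k' + 1 / 2 ^ k' := by
          rw [← add_div, le_div_iff₀ (by positivity)]
          refine (Nat.le_ceil _).trans ?_
          exact_mod_cast (by omega : ⌈f' y * 2 ^ k'⌉₊ ≤ ⌈f' y * 2 ^ k'⌉₊ - 1 + 1)
        have h3 : ((2 : ℕ) : ℝ) / 2 ^ k' = 1 / 2 ^ k' + 1 / 2 ^ k' := by push_cast; ring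
        linarith
  -- The numerator `m` is sought with `(m - 1) / 2 ^ k < f y < (m + 1) / 2 ^ k`. At `m = 0` the
  -- lower bound is waived, as `0 ≤ f y` holds anyway and the subtraction would truncate.
  have h1 : REPred fun q : (β × ℕ) × ℕ => (f q.1.1 < ((q.2 + 1 : ℕ) : ℝ) / 2 ^ q.1.2) ∧
      (q.2 = 0 ∨ ((q.2 - 1 : ℕ) : ℝ) / 2 ^ q.1.2 < f q.1.1) :=
    (hup.comp (f := fun q : (β × ℕ) × ℕ => (q.1.1, q.2 + 1, q.1.2)) (by fun_prop)).and
      ((rePred_eq (by fun_prop) (by fun_prop)).or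
        (hf.comp (f := fun q : (β × ℕ) × ℕ => (q.1.1, q.2 - 1, q.1.2)) (by fun_prop)))
  obtain ⟨g, hg, hgp⟩ := exists_computable_selection h1 (by
    rintro ⟨y, k⟩
    have hf0 := h0 y
    refine ⟨⌊f y * 2 ^ k⌋₊, ?_, ?_⟩
    · rw [lt_div_iff₀ (by positivity)]
      exact_mod_cast Nat.lt_floor_add_one (f y * 2 ^ k)
    · rcases Nat.eq_zero_or_pos ⌊f y * 2 ^ k⌋₊ with h | h
      · exact Or.inl h
      · right
        rw [div_lt_iff₀ (by positivity)]
        refine lt_of_lt_of_le ?_ (Nat.floor_le (by positivity : 0 ≤ f y * 2 ^ k))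
        exact_mod_cast Nat.sub_lt h one_pos)
  refine ⟨fun y k => g (y, k), hg, fun y k => ?_⟩
  obtain ⟨h2, h3 : g (y, k) = 0 ∨ ((g (y, k) - 1 : ℕ) : ℝ) / 2 ^ k < f y⟩ := hgp (y, k)
  simp only [Nat.cast_add, Nat.cast_one, add_div] at h2
  rw [abs_le]
  constructor
  · rcases h3 with h3 | h3
    · have : (0 : ℝ) ≤ 1 / 2 ^ k := by positivity
      have := h0 y
      simp only [h3, Nat.cast_zero, zero_div]
      linarith
    · have h4 : (g (y, k) : ℝ) / 2 ^ k ≤ ((g (y, k) - 1 : ℕ) : ℝ) / 2 ^ k + 1 / 2 ^ k := by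
        rw [← add_div]
        gcongr
        exact_mod_cast (by omega : g (y, k) ≤ g (y, k) - 1 + 1)
      linarith
  · linarith

end Semicomputable

/-! ### Cells -/

section Cells

variable {X : Type*} [MetricSpace X] {β γ : Type*} [Primcodable β] [Primcodable γ] {a : ℕ → X}

theorem rePred_mem_list : REPred fun p : List γ × γ => p.2 ∈ p.1 := by
  have h : PrimrecRel fun (l : List γ) (z : γ) => ∃ b ∈ l, b = z :=
    (Primrec.eq (α := γ)).exists_mem_list
  exact h.computablePred.to_re.of_eq fun p => by simp

theorem Sigma1Family.exists_mem {S : β × γ → Set X} (hS : Sigma1Family a S) :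
    Sigma1Family a fun y : β × List γ => {x | ∃ z ∈ y.2, x ∈ S (y.1, z)} :=
  (hS.comp (f := fun q : (β × List γ) × γ => (q.1.1, q.2)) (by fun_prop)).exists
    (P := fun q : (β × List γ) × γ => q.2 ∈ q.1.2)
    (rePred_mem_list.comp (f := fun q : (β × List γ) × γ => (q.1.2, q.2)) (by fun_prop))

variable [MeasurableSpace X] [BorelSpace X] {μ : Measure X} (𝒜 : Generator a μ)

/-- The `i`-th effectively open half-space, `U i` for the digit `0` and `V i` for the digit `1`. -/
def Generator.half (i : ℕ) (v : Bool) : Set X :=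
  if v = true then sigma1 a (𝒜.codeV i) else sigma1 a (𝒜.codeU i)

omit [BorelSpace X] in
theorem Generator.sigma1Family_half : Sigma1Family a fun p : ℕ × Bool => 𝒜.half p.1 p.2 :=
  (sigma1Family_sigma1 (𝒜.computable_codeV.comp Computable.fst)).ite
    (sigma1Family_sigma1 (𝒜.computable_codeU.comp Computable.fst)) Computable.snd

theorem Generator.measurableSet_half (i : ℕ) (v : Bool) : MeasurableSet (𝒜.half i v) :=
  (𝒜.sigma1Family_half.isOpen (i, v)).measurableSet

omit [BorelSpace X] in
theorem Generator.notMem_half_not {i : ℕ} {v : Bool} {x : X} (h : x ∈ 𝒜.half i v) :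
    x ∉ 𝒜.half i (!v) := by
  intro h'
  have hd := 𝒜.disjoint i
  rw [Set.eq_empty_iff_forall_notMem] at hd
  cases v
  · exact hd x ⟨h, h'⟩
  · exact hd x ⟨h', h⟩

omit [BorelSpace X] in
theorem Generator.mem_A_iff {i : ℕ} {v : Bool} {x : X} (h : x ∈ 𝒜.half i v) :
    x ∈ 𝒜.A i ↔ v = false := by
  cases v
  · simpa using 𝒜.subset i h
  · simpa using fun hA => 𝒜.subset_compl i hA h

/-- Points that are decided by every set of the generator. -/
def Generator.Decided (x : X) : Prop := ∀ i v, x ∈ 𝒜.half i v ∨ x ∈ 𝒜.half i (!v)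

omit [BorelSpace X] in
theorem Generator.decided_iff {x : X} :
    𝒜.Decided x ↔ ∀ i, x ∈ sigma1 a (𝒜.codeU i) ∪ sigma1 a (𝒜.codeV i) := by
  refine forall_congr' fun i => ?_
  simp only [Bool.forall_bool, Generator.half, Set.mem_union]
  simp [or_comm]

theorem Generator.ae_decided [IsProbabilityMeasure μ] : ∀ᵐ x ∂μ, 𝒜.Decided x := by
  simp only [Generator.decided_iff]
  refine ae_all_iff.2 fun i => ?_
  exact (prob_compl_eq_zero_iff
    ((isOpen_sigma1 _).union (isOpen_sigma1 _)).measurableSet).2 (𝒜.measure_union i)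

omit [BorelSpace X] in
theorem Generator.mem_cell {σ : List Bool} {x : X} :
    x ∈ 𝒜.cell σ ↔ ∀ i ∈ List.range σ.length, x ∈ 𝒜.half i (σ.getD i false) := by
  simp only [Generator.cell, Set.mem_ofPred_eq, List.mem_range]
  refine forall₂_congr fun i h => ?_
  simp [Generator.half, h]

omit [BorelSpace X] in
theorem Generator.sigma1Family_cell (ha : IsComputablePolish a) : Sigma1Family a 𝒜.cell := by
  have h := (𝒜.sigma1Family_half.comp
    (f := fun q : List Bool × ℕ => (q.2, q.1.getD q.2 false)) (by fun_prop)).forall_mem ha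
  refine (h.comp (f := fun σ : List Bool => (σ, List.range σ.length)) (by fun_prop)).of_eq
    fun σ => ?_
  ext x
  simp only [Generator.mem_cell, Set.mem_ofPred_eq]

omit [BorelSpace X] in
theorem Generator.cell_nil : 𝒜.cell [] = Set.univ := by
  ext x; simp [Generator.mem_cell]

omit [BorelSpace X] in
theorem Generator.cell_concat (σ : List Bool) (v : Bool) :
    𝒜.cell (σ ++ [v]) = 𝒜.cell σ ∩ 𝒜.half σ.length v := by
  ext x
  simp only [Generator.mem_cell, Set.mem_inter_iff, List.mem_range, List.length_append,
    List.length_singleton]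
  constructor
  · intro h
    refine ⟨fun i hi => ?_, by simpa using h σ.length (by simp)⟩
    have := h i (by omega)
    rwa [List.getD_append _ _ _ _ hi] at this
  · rintro ⟨h1, h2⟩ i hi
    rcases Nat.lt_succ_iff_lt_or_eq.1 hi with hi | rfl
    · rw [List.getD_append _ _ _ _ hi]
      exact h1 i hi
    · simpa using h2

theorem Generator.measurableSet_cell (σ : List Bool) : MeasurableSet (𝒜.cell σ) := by
  induction σ using List.reverseRecOn with
  | nil => rw [Generator.cell_nil]; exact MeasurableSet.univ
  | append_singleton σ v ih =>
    rw [Generator.cell_concat]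
    exact ih.inter (𝒜.measurableSet_half _ _)

/-- An effectively open set that is a.e. equal to the complement of a cell. -/
def Generator.cocell (σ : List Bool) : Set X :=
  {x | ∃ i ∈ List.range σ.length, x ∈ 𝒜.half i (!σ.getD i false)}

omit [BorelSpace X] in
theorem Generator.sigma1Family_cocell : Sigma1Family a 𝒜.cocell := by
  have h := (𝒜.sigma1Family_half.comp
    (f := fun q : List Bool × ℕ => (q.2, !q.1.getD q.2 false)) (by fun_prop)).exists_mem
  exact h.comp (f := fun σ : List Bool => (σ, List.range σ.length)) (by fun_prop)

omit [MetricSpace X] [BorelSpace X] in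
theorem measureReal_inter_add_inter [IsFiniteMeasure μ] {C C' : Set X}
    (hC : MeasurableSet C) (hd : ∀ x ∈ C, x ∉ C') (hcov : ∀ᵐ x ∂μ, x ∈ C ∨ x ∈ C') (S : Set X) :
    μ.real (S ∩ C) + μ.real (S ∩ C') = μ.real S := by
  rw [← measureReal_inter_add_sdiff (μ := μ) (s := S) hC]
  congr 1
  refine measureReal_congr ?_
  filter_upwards [hcov] with x hx
  refine propext ?_
  change (x ∈ S ∧ x ∈ C') ↔ (x ∈ S ∧ x ∉ C)
  have := hd x
  tauto

/-- A decided point outside the cell lies in the opposite half at some index. This makes lower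
bounds on the cocell serve as upper bounds on the cell. -/
theorem Generator.measureReal_cell_add_cocell [IsProbabilityMeasure μ] (S : Set X)
    (σ : List Bool) : μ.real (S ∩ 𝒜.cell σ) + μ.real (S ∩ 𝒜.cocell σ) = μ.real S := by
  refine measureReal_inter_add_inter (𝒜.measurableSet_cell σ) ?_ ?_ S
  · rintro x hx ⟨i, hi, hx'⟩
    exact 𝒜.notMem_half_not (𝒜.mem_cell.1 hx i hi) hx'
  · filter_upwards [𝒜.ae_decided] with x hx
    rw [Generator.mem_cell]
    by_contra! h
    obtain ⟨⟨i, hi, hxi⟩, h2⟩ := h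
    exact h2 ⟨i, hi, (hx i _).resolve_left hxi⟩

theorem Generator.measureReal_cell_concat [IsProbabilityMeasure μ] (S : Set X)
    (σ : List Bool) : μ.real (S ∩ 𝒜.cell (σ ++ [false])) + μ.real (S ∩ 𝒜.cell (σ ++ [true])) =
      μ.real (S ∩ 𝒜.cell σ) := by
  rw [Generator.cell_concat, Generator.cell_concat, ← Set.inter_assoc, ← Set.inter_assoc]
  refine measureReal_inter_add_inter (𝒜.measurableSet_half _ _)
    (fun x hx => 𝒜.notMem_half_not hx) ?_ _
  filter_upwards [𝒜.ae_decided] with x hx using hx _ false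

/-! ### Vitali cover tests from effectively open sets of computable measure -/

/-- The sums over the cell and over the cocell are both approximable from below, and they add up to
`∑ n, μ (G n)`, which does not depend on `σ`. Hence only this total has to be approximable from
above. -/
theorem Generator.isComputableMeasure_tsum (hμ : IsComputableProbabilitySpace a μ)
    {G : ℕ → Set X} (hG : Sigma1Family a G) (hle : ∀ n, μ.real (G n) ≤ (1 / 2) ^ n)
    (hup : UpperApproximable fun n => μ.real (G n)) :
    IsComputableMeasure fun σ => ∑' n, μ.real (G n ∩ 𝒜.cell σ) := by
  have := hμ.prob
  have hs : ∀ C : Set X, Summable fun n => μ.real (G n ∩ C) := fun C =>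
    Summable.of_nonneg_of_le (fun _ => measureReal_nonneg)
      (fun n => (measureReal_mono Set.inter_subset_left).trans (hle n)) summable_geometric_two
  refine ⟨fun σ => tsum_nonneg fun _ => measureReal_nonneg, fun σ => ?_, ?_⟩
  · rw [← (hs _).tsum_add (hs _)]
    simp only [𝒜.measureReal_cell_concat]
  · have hl : ∀ C : List Bool → Set X, Sigma1Family a C →
        LowerApproximable fun σ => ∑' n, μ.real (G n ∩ C σ) := by
      intro C hC
      have h1 : Sigma1Family a fun p : List Bool × ℕ => G p.2 :=
        hG.comp (f := fun p : List Bool × ℕ => p.2) (by fun_prop)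
      have h2 : Sigma1Family a fun p : List Bool × ℕ => C p.1 :=
        hC.comp (f := fun p : List Bool × ℕ => p.1) (by fun_prop)
      have h3 : LowerApproximable fun p : List Bool × ℕ => μ.real (G p.2 ∩ C p.1) :=
        lowerApproximable_measure hμ (h1.inter hμ.polish h2)
      exact h3.tsum (fun _ _ => measureReal_nonneg) fun σ => hs (C σ)
    refine computableNonneg_of_add_eq (hl _ (𝒜.sigma1Family_cell hμ.polish))
      (hl _ 𝒜.sigma1Family_cocell) (hup.tsum (fun _ => measureReal_nonneg) hle)
      (fun _ => tsum_nonneg fun _ => measureReal_nonneg)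
      (fun _ => tsum_nonneg fun _ => measureReal_nonneg) fun σ => ?_
    rw [← (hs _).tsum_add (hs _)]
    simp only [𝒜.measureReal_cell_add_cocell]

/-- Two sequences are kept apart: `V` covers `x`, while `G` has computable measures and supplies the
bounding measure. For Schnorr tests they coincide; for null closed sets `V n` lies in `G n` only up
to a null set, and `x` may be outside `G n`. -/
theorem Generator.vitaliCoverTest_of_le (hμ : IsComputableProbabilitySpace a μ)
    {G V : ℕ → Set X} (hG : Sigma1Family a G) (hV : Sigma1Family a V)
    (hle : ∀ n, μ.real (G n) ≤ (1 / 2) ^ n) (hup : UpperApproximable fun n => μ.real (G n))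
    (hVG : ∀ n σ, μ (V n ∩ 𝒜.cell σ) ≤ μ (G n ∩ 𝒜.cell σ)) {x : X} (hx : ∀ n, x ∈ V n) :
    𝒜.VitaliCoverTest x := by
  have := hμ.prob
  have hs : ∀ σ, ∑' n, μ (V n ∩ 𝒜.cell σ) ≤ ENNReal.ofReal (∑' n, μ.real (G n ∩ 𝒜.cell σ)) := by
    intro σ
    rw [ENNReal.ofReal_tsum_of_nonneg (fun _ => measureReal_nonneg)
      (Summable.of_nonneg_of_le (fun _ => measureReal_nonneg)
        (fun n => (measureReal_mono Set.inter_subset_left).trans (hle n)) summable_geometric_two)]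
    refine ENNReal.tsum_le_tsum fun n => (hVG n σ).trans ?_
    rw [ofReal_measureReal]
  refine ⟨_, V, 𝒜.isComputableMeasure_tsum hμ hG hle hup, ⟨hV.isSigma1Seq, ?_⟩, hs, ?_⟩
  -- The empty string has the whole space as its cell, so its bound gives the finite total measure.
  · have := hs []
    simp only [Generator.cell_nil, Set.inter_univ] at this
    exact this.trans_lt ENNReal.ofReal_lt_top
  · simp only [hx]
    exact Set.infinite_univ

theorem Generator.vitaliCoverTest_of_schnorrTest (hμ : IsComputableProbabilitySpace a μ)
    {U : ℕ → Set X} (hU : IsSchnorrTest a μ U) {x : X} (hx : x ∈ ⋂ n, U n) :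
    𝒜.VitaliCoverTest x := by
  have := hμ.prob
  refine 𝒜.vitaliCoverTest_of_le hμ hU.martinLof.sigma1Seq.sigma1Family
    hU.martinLof.sigma1Seq.sigma1Family (fun n => ?_) hU.computable.upperApproximable
    (fun _ _ => le_rfl) (Set.mem_iInter.1 hx)
  have h := ENNReal.toReal_mono (by finiteness) (hU.martinLof.measure_le n)
  simpa [Measure.real] using h

/-! ### Null effectively closed sets -/

/-- The effectively open part of the Boolean combination `boolComb 𝒜.A t`. -/
def Generator.combInside (t : List (List (ℕ × Bool))) : Set X :=
  {x | ∃ c ∈ t, ∀ l ∈ c, x ∈ 𝒜.half l.1 (!l.2)}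

/-- The effectively open part of the complement of the Boolean combination `boolComb 𝒜.A t`. -/
def Generator.combOutside (t : List (List (ℕ × Bool))) : Set X :=
  {x | ∀ c ∈ t, ∃ l ∈ c, x ∈ 𝒜.half l.1 l.2}

omit [BorelSpace X] in
theorem Generator.sigma1Family_combInside (ha : IsComputablePolish a) :
    Sigma1Family a 𝒜.combInside := by
  have h := ((𝒜.sigma1Family_half.comp
    (f := fun q : (Unit × Unit) × (ℕ × Bool) => (q.2.1, !q.2.2)) (by fun_prop)).forall_mem ha)
  have h2 := (h.comp (f := fun q : Unit × List (ℕ × Bool) => (((), ()), q.2))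
    (by fun_prop)).exists_mem
  exact h2.comp (f := fun t : List (List (ℕ × Bool)) => ((), t)) (by fun_prop)

omit [BorelSpace X] in
theorem Generator.sigma1Family_combOutside (ha : IsComputablePolish a) :
    Sigma1Family a 𝒜.combOutside := by
  have h := ((𝒜.sigma1Family_half.comp
    (f := fun q : (Unit × Unit) × (ℕ × Bool) => (q.2.1, q.2.2)) (by fun_prop)).exists_mem)
  have h2 := (h.comp (f := fun q : Unit × List (ℕ × Bool) => (((), ()), q.2))
    (by fun_prop)).forall_mem ha
  exact h2.comp (f := fun t : List (List (ℕ × Bool)) => ((), t)) (by fun_prop)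

omit [BorelSpace X] in
theorem Generator.combInside_subset (t : List (List (ℕ × Bool))) :
    𝒜.combInside t ⊆ boolComb 𝒜.A t := by
  rintro x ⟨c, hc, h⟩
  refine ⟨c, hc, fun l hl => ?_⟩
  -- The open part of `A i` is `U i`, which carries the digit `false`; hence the negated sign in
  -- `combInside`.
  rw [𝒜.mem_A_iff (h l hl)]
  simp

omit [BorelSpace X] in
theorem Generator.Decided.mem_combInside {x : X} (hx : 𝒜.Decided x)
    {t : List (List (ℕ × Bool))} (h : x ∈ boolComb 𝒜.A t) : x ∈ 𝒜.combInside t := by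
  obtain ⟨c, hc, h⟩ := h
  refine ⟨c, hc, fun l hl => (hx l.1 l.2).resolve_left fun hx' => ?_⟩
  have h1 := h l hl
  rw [𝒜.mem_A_iff hx'] at h1
  cases h2 : l.2 <;> simp [h2] at h1

omit [BorelSpace X] in
theorem Generator.notMem_combOutside {x : X} {t : List (List (ℕ × Bool))}
    (h : x ∈ 𝒜.combInside t) : x ∉ 𝒜.combOutside t := by
  obtain ⟨c, hc, h⟩ := h
  intro h'
  obtain ⟨l, hl, hx⟩ := h' c hc
  exact 𝒜.notMem_half_not hx (h l hl)

omit [BorelSpace X] in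
theorem Generator.Decided.mem_combInside_or {x : X} (hx : 𝒜.Decided x)
    (t : List (List (ℕ × Bool))) : x ∈ 𝒜.combInside t ∨ x ∈ 𝒜.combOutside t := by
  by_contra! h
  simp only [Generator.combInside, Generator.combOutside, Set.mem_ofPred_eq] at h
  push Not at h
  obtain ⟨h1, c, hc, h2⟩ := h
  obtain ⟨l, hl, h3⟩ := h1 c hc
  exact h3 ((hx l.1 l.2).resolve_left (h2 l hl))

theorem Generator.measureReal_combInside_add [IsProbabilityMeasure μ]
    (t : List (List (ℕ × Bool))) (ha : IsComputablePolish a) :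
    μ.real (𝒜.combInside t) + μ.real (𝒜.combOutside t) = 1 := by
  have h := measureReal_inter_add_inter (μ := μ) (C' := 𝒜.combOutside t)
    ((𝒜.sigma1Family_combInside ha).isOpen t).measurableSet
    (fun x hx => 𝒜.notMem_combOutside hx)
    (by filter_upwards [𝒜.ae_decided] with x hx using Generator.Decided.mem_combInside_or 𝒜 hx t)
    Set.univ
  simpa using h

/-- A finite union of balls, each shrunk by `1 / (s + 1)`. -/
def shrunkUnion (a : ℕ → X) (p : List (ℕ × ℕ × ℕ) × ℕ) : Set X :=
  {x | ∃ b ∈ p.1, dist x (a b.1) + 1 / ((p.2 : ℝ) + 1) < radius b}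

/-- The exterior of a finite union of balls, each shrunk by `1 / (s + 1)`. -/
def shrunkExterior (a : ℕ → X) (p : List (ℕ × ℕ × ℕ) × ℕ) : Set X :=
  {x | ∀ b ∈ p.1, radius b < dist x (a b.1) + 1 / ((p.2 : ℝ) + 1)}

omit [MeasurableSpace X] [BorelSpace X] in
theorem sigma1Family_shrunkUnion (ha : IsComputablePolish a) :
    Sigma1Family a (shrunkUnion a) := by
  have h := ((sigma1Family_shrunkBall ha).comp
    (f := fun q : ℕ × (ℕ × ℕ × ℕ) => (q.2, q.1)) (by fun_prop)).exists_mem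
  exact h.comp (f := fun p : List (ℕ × ℕ × ℕ) × ℕ => (p.2, p.1)) (by fun_prop)

omit [MeasurableSpace X] [BorelSpace X] in
theorem sigma1Family_shrunkExterior (ha : IsComputablePolish a) :
    Sigma1Family a (shrunkExterior a) := by
  have h := ((sigma1Family_exteriorBall ha).comp
    (f := fun q : ℕ × (ℕ × ℕ × ℕ) => (q.2, q.1)) (by fun_prop)).forall_mem ha
  exact h.comp (f := fun p : List (ℕ × ℕ × ℕ) × ℕ => (p.2, p.1)) (by fun_prop)

omit [MeasurableSpace X] [BorelSpace X] in
theorem shrunkUnion_subset {w w' : List (ℕ × ℕ × ℕ)} {s s' : ℕ} (hw : w ⊆ w') (hs : s ≤ s') :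
    shrunkUnion a (w, s) ⊆ shrunkUnion a (w', s') := by
  rintro x ⟨b, hb, hx⟩
  refine ⟨b, hw hb, lt_of_le_of_lt ?_ hx⟩
  have : (s : ℝ) ≤ s' := by exact_mod_cast hs
  gcongr

-- Continuity from below: the open set is the directed union of shrunken finite unions of its balls,
-- over countably many indices.
omit [BorelSpace X] in
theorem exists_lt_measure_shrunkUnion {e : Nat.Partrec.Code} {r : ℝ≥0∞}
    (hr : r < μ (sigma1 a e)) :
    ∃ w s, (∀ b ∈ w, b ∈ ceSet (ℕ × ℕ × ℕ) e) ∧ r < μ (shrunkUnion a (w, s)) := by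
  let ι := {p : List (ℕ × ℕ × ℕ) × ℕ // ∀ b ∈ p.1, b ∈ ceSet (ℕ × ℕ × ℕ) e}
  have hU : sigma1 a e ⊆ ⋃ p : ι, shrunkUnion a p.1 := by
    intro x hx
    obtain ⟨b, hb, hxb⟩ := mem_sigma1.1 hx
    obtain ⟨s, hs⟩ := exists_nat_one_div_lt (sub_pos.2 (mem_basicBall.1 hxb))
    refine Set.mem_iUnion.2 ⟨⟨([b], s), by simpa using hb⟩, b, by simp, ?_⟩
    linarith
  have hd : Directed (· ⊆ ·) fun p : ι => shrunkUnion a p.1 := by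
    rintro ⟨⟨w, s⟩, h⟩ ⟨⟨w', s'⟩, h'⟩
    refine ⟨⟨(w ++ w', max s s'), fun b hb => ?_⟩,
      shrunkUnion_subset (List.subset_append_left _ _) (le_max_left _ _),
      shrunkUnion_subset (List.subset_append_right _ _) (le_max_right _ _)⟩
    exact (List.mem_append.1 hb).elim (h b) (h' b)
  have h := hr.trans_le (measure_mono hU)
  rw [hd.measure_iUnion] at h
  obtain ⟨⟨⟨w, s⟩, hw⟩, hlt⟩ := lt_iSup_iff.1 h
  exact ⟨w, s, hw, hlt⟩

-- Continuity from below again; flattening a list of disjunctive normal forms gives their union as a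
-- single Boolean combination.
omit [MetricSpace X] [BorelSpace X] in
theorem exists_lt_measure_boolComb {A : ℕ → Set X} {e : Nat.Partrec.Code} {r : ℝ≥0∞}
    (hr : r < μ (⋃ t ∈ ceSet (List (List (ℕ × Bool))) e, boolComb A t)) :
    ∃ T : List (List (List (ℕ × Bool))), (∀ t ∈ T, t ∈ ceSet (List (List (ℕ × Bool))) e) ∧
      r < μ (boolComb A T.flatten) := by
  let ι := {T : List (List (List (ℕ × Bool))) // ∀ t ∈ T, t ∈ ceSet (List (List (ℕ × Bool))) e}
  have hU : (⋃ t ∈ ceSet (List (List (ℕ × Bool))) e, boolComb A t) ⊆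
      ⋃ T : ι, boolComb A T.1.flatten := by
    refine Set.iUnion₂_subset fun t ht => ?_
    refine Set.subset_iUnion_of_subset (⟨[t], by simpa using ht⟩ : ι) ?_
    simp
  have hd : Directed (· ⊆ ·) fun T : ι => boolComb A T.1.flatten := by
    rintro ⟨T, h⟩ ⟨T', h'⟩
    refine ⟨⟨T ++ T', fun t ht => (List.mem_append.1 ht).elim (h t) (h' t)⟩, ?_, ?_⟩
    · rintro x ⟨c, hc, hx⟩
      exact ⟨c, by rw [List.flatten_append]; exact List.mem_append_left _ hc, hx⟩
    · rintro x ⟨c, hc, hx⟩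
      exact ⟨c, by rw [List.flatten_append]; exact List.mem_append_right _ hc, hx⟩
  have h := hr.trans_le (measure_mono hU)
  rw [hd.measure_iUnion] at h
  obtain ⟨⟨T, hT⟩, hlt⟩ := lt_iSup_iff.1 h
  exact ⟨T, hT, hlt⟩

/-- The open set has measure one, so finitely many of its balls, slightly shrunk, have a union `W`
of measure above `1 - 2⁻ⁿ`. Shrinking makes the exterior `V n` an open set that contains `x` even if
`x` lies on the boundary of the balls. The measure of `V n` need not be computable, so `W` is
replaced by a finite Boolean combination of the `A i`, a.e. contained in `W` and still of measure
above `1 - 2⁻ⁿ`. The open part `G n` of its complement a.e. contains `V n`, and its measure is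
computable because the open parts of the combination and of its complement have total measure one.
-/
theorem Generator.vitaliCoverTest_of_null (hμ : IsComputableProbabilitySpace a μ)
    {e : Nat.Partrec.Code} (he : μ (sigma1 a e)ᶜ = 0) {x : X} (hx : x ∈ (sigma1 a e)ᶜ) :
    𝒜.VitaliCoverTest x := by
  have := hμ.prob
  have ha := hμ.polish
  obtain ⟨F, hF, hFe⟩ := 𝒜.generates
  obtain ⟨c, hc, hcW⟩ := (sigma1Family_shrunkUnion ha).exists_code
  have h1 : REPred fun q : ℕ × (List (ℕ × ℕ × ℕ) × ℕ) × List (List (List (ℕ × Bool))) =>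
      ∀ b ∈ q.2.1.1, b ∈ ceSet (ℕ × ℕ × ℕ) e :=
    (rePred_ceSet (α := ℕ × ℕ × ℕ)).forall_mem.comp (f := fun q :
      ℕ × (List (ℕ × ℕ × ℕ) × ℕ) × List (List (List (ℕ × Bool))) => (e, q.2.1.1)) (by fun_prop)
  have h2 : REPred fun q : ℕ × (List (ℕ × ℕ × ℕ) × ℕ) × List (List (List (ℕ × Bool))) =>
      ∀ t ∈ q.2.2, t ∈ ceSet (List (List (ℕ × Bool))) (F (c q.2.1)) :=
    (rePred_ceSet (α := List (List (ℕ × Bool)))).forall_mem.comp (f := fun q :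
      ℕ × (List (ℕ × ℕ × ℕ) × ℕ) × List (List (List (ℕ × Bool))) => (F (c q.2.1), q.2.2))
      (by fun_prop)
  have h3 : REPred fun q : ℕ × (List (ℕ × ℕ × ℕ) × ℕ) × List (List (List (ℕ × Bool))) =>
      ((2 ^ q.1 - 1 : ℕ) : ℝ) / 2 ^ q.1 < μ.real (𝒜.combInside q.2.2.flatten) :=
    (lowerApproximable_measure hμ (𝒜.sigma1Family_combInside ha)).comp (f := fun q :
      ℕ × (List (ℕ × ℕ × ℕ) × ℕ) × List (List (List (ℕ × Bool))) =>
        (q.2.2.flatten, 2 ^ q.1 - 1, q.1)) (by fun_prop)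
  have hpow : ∀ n : ℕ, ((2 ^ n - 1 : ℕ) : ℝ) / 2 ^ n = 1 - (1 / 2) ^ n := by
    intro n
    rw [Nat.cast_sub Nat.one_le_two_pow]
    push_cast
    rw [sub_div, div_self (by positivity), one_div_pow]
  -- All requirements on the balls, the shrinking parameter and the Boolean combination are c.e., so
  -- existence for each `n` suffices to find them computably.
  obtain ⟨f, hf, hfp⟩ := exists_computable_selection (h1.and (h2.and h3)) (by
    intro n
    have hr : ENNReal.ofReal (1 - (1 / 2) ^ n) < μ (sigma1 a e) := by
      rw [(prob_compl_eq_zero_iff (isOpen_sigma1 e).measurableSet).1 he,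
        ← ENNReal.ofReal_one, ENNReal.ofReal_lt_ofReal_iff one_pos]
      have : (0 : ℝ) < (1 / 2) ^ n := by positivity
      linarith
    obtain ⟨w, s, hw, hlt⟩ := exists_lt_measure_shrunkUnion hr
    rw [hcW, measure_congr (hFe _)] at hlt
    obtain ⟨T, hT, hlt⟩ := exists_lt_measure_boolComb hlt
    refine ⟨((w, s), T), hw, hT, ?_⟩
    rw [hpow]
    have h5 : μ (boolComb 𝒜.A T.flatten) ≤ μ (𝒜.combInside T.flatten) := by
      refine measure_mono_ae ?_
      filter_upwards [𝒜.ae_decided] with y hy using Generator.Decided.mem_combInside 𝒜 hy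
    have h6 : 0 ≤ 1 - (1 / 2 : ℝ) ^ n := by
      have : (1 / 2 : ℝ) ^ n ≤ 1 := pow_le_one₀ (by norm_num) (by norm_num)
      linarith
    exact (ENNReal.ofReal_lt_iff_lt_toReal h6 (by finiteness)).1 (hlt.trans_le h5))
  have hadd : ∀ n, μ.real (𝒜.combInside (f n).2.flatten) +
      μ.real (𝒜.combOutside (f n).2.flatten) = 1 := fun n =>
    𝒜.measureReal_combInside_add _ ha
  refine 𝒜.vitaliCoverTest_of_le hμ (G := fun n => 𝒜.combOutside (f n).2.flatten)
    (V := fun n => shrunkExterior a (f n).1) ?_ ?_ ?_ ?_ ?_ ?_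
  · exact (𝒜.sigma1Family_combOutside ha).comp (by fun_prop)
  · exact (sigma1Family_shrunkExterior ha).comp (by fun_prop)
  · intro n
    obtain ⟨-, -, h⟩ := hfp n
    rw [hpow] at h
    have := hadd n
    simp only at h
    linarith
  -- `μ (G n) < m / 2 ^ k` means that `1 - m / 2 ^ k` is below the measure of the inner part. The
  -- case `m > 2 ^ k`, where the subtraction would truncate, is always true.
  · have h4 : REPred fun p : ℕ × ℕ × ℕ => 2 ^ p.2.2 < p.2.1 ∨ ((2 ^ p.2.2 - p.2.1 : ℕ) : ℝ) /
        2 ^ p.2.2 < μ.real (𝒜.combInside (f p.1).2.flatten) :=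
      (AlgRand.rePred_lt (by fun_prop) (by fun_prop)).or
        ((lowerApproximable_measure hμ (𝒜.sigma1Family_combInside ha)).comp
          (f := fun p : ℕ × ℕ × ℕ => ((f p.1).2.flatten, 2 ^ p.2.2 - p.2.1, p.2.2)) (by fun_prop))
    refine h4.of_eq ?_
    rintro ⟨n, m, k⟩
    simp only
    have hn := hadd n
    have h2k : (0 : ℝ) < 2 ^ k := by positivity
    by_cases hmk : 2 ^ k < m
    · have h5 : (1 : ℝ) < m / 2 ^ k := by
        rw [lt_div_iff₀ h2k, one_mul]
        exact_mod_cast hmk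
      have := measureReal_nonneg (μ := μ) (s := 𝒜.combInside (f n).2.flatten)
      simp only [hmk, true_or, true_iff]
      linarith
    · rw [Nat.cast_sub (not_lt.1 hmk)]
      simp only [hmk, false_or]
      push_cast
      rw [sub_div, div_self h2k.ne']
      constructor <;> intro h <;> linarith
  · intro n σ
    obtain ⟨-, hT, -⟩ := hfp n
    refine measure_mono_ae ?_
    -- A decided point outside `G n` satisfies the Boolean combination, so almost surely it lies in
    -- the shrunken union, which is disjoint from its exterior `V n`.
    filter_upwards [𝒜.ae_decided, hFe (c (f n).1)] with y hy hye hyV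
    refine ⟨(Generator.Decided.mem_combInside_or 𝒜 hy _).resolve_left fun hyD => ?_, hyV.2⟩
    obtain ⟨d, hd, hyd⟩ := 𝒜.combInside_subset _ hyD
    obtain ⟨t, ht, hdt⟩ := List.mem_flatten.1 hd
    have h7 : y ∈ sigma1 a (c (f n).1) := by
      have : (y ∈ sigma1 a (c (f n).1)) = _ := hye
      rw [this]
      exact Set.mem_iUnion₂.2 ⟨t, hT t ht, d, hdt, hyd⟩
    rw [← hcW] at h7
    obtain ⟨b, hb, hyb⟩ := h7
    exact lt_asymm hyb (hyV.1 b hb)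
  · intro n b hb
    obtain ⟨hw, -, -⟩ := hfp n
    have h8 : x ∉ basicBall a b := fun h => hx (mem_sigma1.2 ⟨b, hw b hb, h⟩)
    rw [mem_basicBall, not_lt] at h8
    have : 0 < 1 / (((f n).1.2 : ℝ) + 1) := by positivity
    linarith

end Cells

/-! ### Tests refuting Martin-Löf randomness -/

section MartinLof

variable {X : Type*} [MetricSpace X] [MeasurableSpace X] [BorelSpace X] {a : ℕ → X} {μ : Measure X}

theorem le_two_inv_pow_of_mul_le {m : ℝ≥0∞} {n C : ℕ} (hC : 0 < C)
    (h : ((2 ^ n * C : ℕ) : ℝ≥0∞) * m ≤ C) : m ≤ (2⁻¹ : ℝ≥0∞) ^ n := by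
  have hC0 : (C : ℝ≥0∞) ≠ 0 := by exact_mod_cast hC.ne'
  rw [← ENNReal.inv_pow, ENNReal.le_inv_iff_mul_le, mul_comm,
    ← ENNReal.mul_le_mul_iff_right hC0 (ENNReal.natCast_ne_top C), mul_one, ← mul_assoc]
  refine le_trans (le_of_eq ?_) h
  push_cast
  ring

omit [MetricSpace X] [BorelSpace X] in
theorem mul_measure_le_of_forall_le {U : Set X} (hU : MeasurableSet U) {g : X → ℝ≥0∞} {c : ℝ≥0∞}
    (h : ∀ x ∈ U, c ≤ g x) : c * μ U ≤ ∫⁻ x, g x ∂μ := by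
  rw [← setLIntegral_const]
  exact (setLIntegral_mono' hU h).trans (setLIntegral_le_lintegral _ _)

theorem rePred_nodup : REPred fun l : List ℕ => l.Nodup := by
  have h1 : REPred fun q : (List ℕ × ℕ) × ℕ => q.1.1.getD q.2 0 < q.1.1.getD q.1.2 0 ∨
      q.1.1.getD q.1.2 0 < q.1.1.getD q.2 0 :=
    (AlgRand.rePred_lt (by fun_prop) (by fun_prop)).or
      (AlgRand.rePred_lt (by fun_prop) (by fun_prop))
  have h2 := h1.forall_mem.comp (f := fun q : List ℕ × ℕ => (q, List.range q.2)) (by fun_prop)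
  have h3 := h2.forall_mem.comp (f := fun l : List ℕ => (l, List.range l.length)) (by fun_prop)
  refine h3.of_eq fun l => ?_
  rw [List.nodup_iff_pairwise_ne, List.pairwise_iff_getElem]
  simp only [List.mem_range, ← ne_iff_lt_or_gt]
  constructor
  · intro h i j hi hj hij
    simpa [hi, hj] using h j hj i hij
  · intro h j hj i hij
    have hi := hij.trans hj
    simpa [hi, hj] using h i j hi hj hij

/-- Markov's inequality for `∑ n, 1_{V n}`, whose integral is below `C`: the points lying in at
least `2 ^ k * C` of the sets have measure at most `2⁻ᵏ`. Duplicate-free lists of indices witness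
this effectively. -/
theorem IsVitaliTest.not_martinLofRandom (hμ : IsComputableProbabilitySpace a μ) {V : ℕ → Set X}
    (hV : IsVitaliTest a μ V) {x : X} (hx : {n | x ∈ V n}.Infinite) : ¬ MartinLofRandom a μ x := by
  obtain ⟨C, hC⟩ := ENNReal.exists_nat_gt hV.tsum_lt_top.ne
  have hC0 : 0 < C := by
    rcases Nat.eq_zero_or_pos C with rfl | h
    · simp at hC
    · exact h
  have hVf := hV.sigma1Seq.sigma1Family
  let U : ℕ → Set X := fun k => {y | ∃ l : List ℕ, (l.Nodup ∧ l.length = 2 ^ k * C) ∧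
    ∀ n ∈ l, y ∈ V n}
  have hU : Sigma1Family a U := by
    have h1 := (hVf.comp (f := fun q : ℕ × ℕ => q.2) (by fun_prop)).forall_mem hμ.polish
    exact h1.exists (P := fun q : ℕ × List ℕ => q.2.Nodup ∧ q.2.length = 2 ^ q.1 * C)
      ((rePred_nodup.comp (f := fun q : ℕ × List ℕ => q.2) (by fun_prop)).and
        (rePred_eq (by fun_prop) (by fun_prop)))
  refine not_not_intro ⟨U, ⟨hU.isSigma1Seq, fun k => ?_⟩, Set.mem_iInter.2 fun k => ?_⟩
  · refine le_two_inv_pow_of_mul_le hC0 (le_trans ?_ hC.le)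
    have hm : ∀ n, MeasurableSet (V n) := fun n => (hVf.isOpen n).measurableSet
    have h2 : ∑' n, μ (V n) = ∫⁻ y, ∑' n, (V n).indicator 1 y ∂μ := by
      rw [lintegral_tsum fun n => (measurable_one.indicator (hm n)).aemeasurable]
      simp only [lintegral_indicator_one (hm _)]
    rw [h2]
    refine mul_measure_le_of_forall_le (hU.isOpen k).measurableSet ?_
    rintro y ⟨l, ⟨hl, hlen⟩, hy⟩
    refine le_trans (le_of_eq ?_) (ENNReal.sum_le_tsum l.toFinset)
    rw [Finset.sum_congr rfl fun n hn => Set.indicator_of_mem (hy n (List.mem_toFinset.1 hn)) _]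
    simp [List.toFinset_card_of_nodup hl, hlen]
  · obtain ⟨s, hs, hcard⟩ := hx.exists_subset_card_eq (2 ^ k * C)
    exact ⟨s.toList, ⟨s.nodup_toList, by simpa using hcard⟩,
      fun n hn => hs (Finset.mem_toList.1 hn)⟩

theorem Generator.VitaliCoverTest.not_martinLofRandom (hμ : IsComputableProbabilitySpace a μ)
    {𝒜 : Generator a μ} {x : X} (h : 𝒜.VitaliCoverTest x) : ¬ MartinLofRandom a μ x := by
  obtain ⟨_, V, _, hV, _, hx⟩ := h
  exact hV.not_martinLofRandom hμ hx

omit [BorelSpace X] in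
theorem Generator.BoundedMartinLofTest.not_martinLofRandom {𝒜 : Generator a μ} {x : X}
    (h : 𝒜.BoundedMartinLofTest x) : ¬ MartinLofRandom a μ x := by
  obtain ⟨_, U, _, hU, _, hx⟩ := h
  exact not_not_intro ⟨U, hU, hx⟩

/-! ### Superlevel sets and integral tests -/

theorem denseRange_ratPoint : DenseRange ratPoint := by
  refine (Rat.denseRange_cast (𝕜 := ℝ)).mono ?_
  rintro _ ⟨q, rfl⟩
  refine ⟨Nat.pair (Nat.pair q.num.toNat (-q.num).toNat) (q.den - 1), ?_⟩
  have h1 : ((q.num.toNat : ℤ) - ((-q.num).toNat : ℤ)) = q.num := by omega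
  have h2 : ((q.num.toNat : ℝ) - ((-q.num).toNat : ℝ)) = q.num := by exact_mod_cast h1
  have h3 : ((q.den - 1 : ℕ) : ℝ) + 1 = q.den := by
    exact_mod_cast Nat.succ_pred_eq_of_pos q.den_pos
  simp only [ratPoint, Nat.unpair_pair]
  rw [h2, h3, Rat.cast_def]

/-- The rational intervals enumerated are those whose left end is at least `c n`; as they are open,
the weak inequality suffices. -/
theorem exists_code_Ioi {c : ℕ → ℕ} (hc : Computable c) :
    ∃ e : ℕ → Nat.Partrec.Code, Computable e ∧ ∀ n, sigma1 ratPoint (e n) = Set.Ioi (c n : ℝ) := by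
  have h : REPred fun q : ℕ × (ℕ × ℕ × ℕ) =>
      c q.1 * ((q.2.1.unpair.2 + 1) * (q.2.2.2 + 1)) +
        (q.2.1.unpair.1.unpair.2 * (q.2.2.2 + 1) + (q.2.2.1 + 1) * (q.2.1.unpair.2 + 1)) ≤
      q.2.1.unpair.1.unpair.1 * (q.2.2.2 + 1) := rePred_le (by fun_prop) (by fun_prop)
  obtain ⟨e, he, heq⟩ := exists_computable_code h
  have key : ∀ n b, b ∈ ceSet (ℕ × ℕ × ℕ) (e n) ↔ (c n : ℝ) + radius b ≤ ratPoint b.1 := by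
    intro n b
    rw [heq]
    simp only [radius, ratPoint]
    rw [← Nat.cast_le (α := ℝ), le_div_iff₀ (by positivity)]
    push_cast
    have h1 : ((c n : ℝ) + (b.2.1 + 1) / (b.2.2 + 1)) * (b.1.unpair.2 + 1) * (b.2.2 + 1) =
        c n * ((b.1.unpair.2 + 1) * (b.2.2 + 1)) + (b.2.1 + 1) * (b.1.unpair.2 + 1) := by
      field_simp
    rw [← mul_le_mul_iff_left₀ (by positivity : (0 : ℝ) < (b.2.2 : ℝ) + 1) (c := _ - _), h1]
    constructor <;> intro h <;> linarith
  refine ⟨e, he, fun n => Set.ext fun y => ?_⟩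
  simp only [mem_sigma1, key, Set.mem_Ioi]
  constructor
  · rintro ⟨b, hb, hy⟩
    rw [mem_basicBall, Real.dist_eq] at hy
    have := (abs_lt.1 hy).1
    linarith
  · intro hy
    obtain ⟨b, hyb, hb⟩ := exists_basicBall_mem denseRange_ratPoint y (half_pos (sub_pos.2 hy))
    refine ⟨b, ?_, hyb⟩
    rw [mem_basicBall, Real.dist_eq] at hyb
    have := (abs_lt.1 hyb).2
    linarith

/-- Only the bound at the empty string is used, with Markov's inequality. The strict superlevel set
of the supremum `g` is the union of those of the computable functions `f m`, hence effectively open.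
-/
theorem Generator.IntegralTest.not_martinLofRandom {𝒜 : Generator a μ} {x : X}
    (h : 𝒜.IntegralTest x) : ¬ MartinLofRandom a μ x := by
  obtain ⟨ν, g, -, ⟨f, ⟨F, hF, hFf⟩, hf0, hg⟩, hν, hx⟩ := h
  obtain ⟨C, hC⟩ := ENNReal.exists_nat_gt (ENNReal.ofReal_ne_top (r := ν []))
  have hC0 : 0 < C := by
    rcases Nat.eq_zero_or_pos C with rfl | h
    · simp at hC
    · exact h
  obtain ⟨e, he, heq⟩ := exists_code_Ioi (c := fun n => 2 ^ n * C) (by fun_prop)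
  have hS : Sigma1Family a fun q : ℕ × ℕ => f q.2 ⁻¹' Set.Ioi ((2 ^ q.1 * C : ℕ) : ℝ) := by
    refine (sigma1Family_sigma1 (c := fun q : ℕ × ℕ => F q.2 (e q.1))
      (hF.comp (f := F) Computable.snd (he.comp Computable.fst))).of_eq fun q => ?_
    rw [← hFf, heq]
  have hU := hS.iUnion
  refine not_not_intro ⟨_, ⟨hU.isSigma1Seq, fun n => ?_⟩, Set.mem_iInter.2 fun n => ?_⟩
  · refine le_two_inv_pow_of_mul_le hC0 (le_trans ?_ ((hν []).trans hC.le))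
    rw [Generator.cell_nil, Measure.restrict_univ]
    refine mul_measure_le_of_forall_le (hU.isOpen n).measurableSet ?_
    intro y hy
    obtain ⟨m, hm⟩ := Set.mem_iUnion.1 hy
    rw [hg]
    refine le_iSup_of_le m ?_
    rw [ENNReal.le_ofReal_iff_toReal_le (by finiteness) (hf0 _ _)]
    have h1 : ((2 ^ n * C : ℕ) : ℝ) < f m y := hm
    simpa using h1.le
  · have h1 : ((2 ^ n * C : ℕ) : ℝ≥0∞) < g x := by rw [hx]; exact ENNReal.natCast_lt_top _
    rw [hg] at h1
    obtain ⟨m, hm⟩ := lt_iSup_iff.1 h1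
    refine Set.mem_iUnion.2 ⟨m, ?_⟩
    rw [ENNReal.lt_ofReal_iff_toReal_lt (by finiteness)] at hm
    simpa using hm

/-! ### Null cells and unrepresented points -/

omit [BorelSpace X] in
theorem Generator.not_martinLofRandom_of_inNullCell (hμ : IsComputableProbabilitySpace a μ)
    {𝒜 : Generator a μ} {x : X} (h : 𝒜.InNullCell x) : ¬ MartinLofRandom a μ x := by
  obtain ⟨σ, hσ, hx⟩ := h
  have hU := (𝒜.sigma1Family_cell hμ.polish).comp (f := fun _ : ℕ => σ) (by fun_prop)
  exact not_not_intro ⟨_, ⟨hU.isSigma1Seq, fun n => by simp [hσ]⟩, Set.mem_iInter.2 fun n => hx⟩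

omit [BorelSpace X] in
theorem Generator.Decided.exists_isName {𝒜 : Generator a μ} {x : X} (hx : 𝒜.Decided x) :
    ∃ z, 𝒜.IsName x z := by
  classical
  refine ⟨fun i => decide (x ∈ 𝒜.half i true), fun n => 𝒜.mem_cell.2 fun i hi => ?_⟩
  have hi : i < n := by simpa [initSeg] using hi
  have h1 : (initSeg (fun i => decide (x ∈ 𝒜.half i true)) n).getD i false =
      decide (x ∈ 𝒜.half i true) := by simp [initSeg, hi]
  rw [h1]
  by_cases h : x ∈ 𝒜.half i true
  · simp [h]
  · simpa [h] using (hx i true).resolve_left h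

theorem Generator.not_martinLofRandom_of_unrepresented (hμ : IsComputableProbabilitySpace a μ)
    {𝒜 : Generator a μ} {x : X} (h : 𝒜.Unrepresented x) : ¬ MartinLofRandom a μ x := by
  have := hμ.prob
  have h1 : ¬ 𝒜.Decided x := fun hd => h hd.exists_isName
  rw [𝒜.decided_iff] at h1
  push Not at h1
  obtain ⟨i, hi⟩ := h1
  obtain ⟨c, -, hc⟩ := ((sigma1Family_sigma1 (a := a) 𝒜.computable_codeU).union
    (sigma1Family_sigma1 𝒜.computable_codeV)).exists_code
  have h2 := 𝒜.measure_union i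
  rw [hc] at hi h2
  exact (𝒜.vitaliCoverTest_of_null hμ
    ((prob_compl_eq_zero_iff (isOpen_sigma1 _).measurableSet).2 h2) hi).not_martinLofRandom hμ

/-! ### Ville's inequality -/

/-- The points of `[σ]` caught by a cell whose string lies in `S` and extends `σ` by at most `L`
digits. -/
def Generator.caught (𝒜 : Generator a μ) (S : Set (List Bool)) : ℕ → List Bool → Set X
  | 0, σ => {x | σ ∈ S ∧ x ∈ 𝒜.cell σ}
  | L + 1, σ => {x | σ ∈ S ∧ x ∈ 𝒜.cell σ} ∪
      (𝒜.caught S L (σ ++ [false]) ∪ 𝒜.caught S L (σ ++ [true]))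

omit [BorelSpace X] in
theorem Generator.caught_subset_cell (𝒜 : Generator a μ) (S : Set (List Bool)) (L : ℕ)
    (σ : List Bool) : 𝒜.caught S L σ ⊆ 𝒜.cell σ := by
  induction L generalizing σ with
  | zero => exact fun x hx => hx.2
  | succ L ih =>
    have h : ∀ v, 𝒜.caught S L (σ ++ [v]) ⊆ 𝒜.cell σ := fun v =>
      (ih _).trans (by rw [Generator.cell_concat]; exact Set.inter_subset_left)
    exact Set.union_subset (fun x hx => hx.2) (Set.union_subset (h _) (h _))

omit [BorelSpace X] in
theorem Generator.caught_subset_succ (𝒜 : Generator a μ) (S : Set (List Bool)) (L : ℕ)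
    (σ : List Bool) : 𝒜.caught S L σ ⊆ 𝒜.caught S (L + 1) σ := by
  induction L generalizing σ with
  | zero => exact Set.subset_union_left
  | succ L ih => exact Set.union_subset_union_right _ (Set.union_subset_union (ih _) (ih _))

omit [BorelSpace X] in
theorem Generator.cell_subset_caught (𝒜 : Generator a μ) {S : Set (List Bool)} (ρ : List Bool)
    (σ : List Bool) (h : σ ++ ρ ∈ S) : 𝒜.cell (σ ++ ρ) ⊆ 𝒜.caught S ρ.length σ := by
  induction ρ generalizing σ with
  | nil => rw [List.append_nil] at *; exact fun x hx => ⟨h, hx⟩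
  | cons v ρ ih =>
    have h1 := ih (σ ++ [v]) (by simpa using h)
    rw [List.append_assoc, List.singleton_append] at h1
    refine h1.trans (Set.subset_union_of_subset_right ?_ _)
    cases v
    · exact Set.subset_union_left
    · exact Set.subset_union_right

-- If `σ ∈ S`, the bound `c ≤ M σ` on the whole cell suffices; otherwise fairness passes the
-- estimate to the two children. Induction on the depth avoids selecting minimal strings of `S`.
omit [BorelSpace X] in
theorem Generator.mul_measureReal_caught_le [IsProbabilityMeasure μ] {𝒜 : Generator a μ}
    {M : List Bool → ℝ} (hM : 𝒜.IsComputableMartingale M) {c : ℝ} {S : Set (List Bool)}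
    (hS : ∀ σ ∈ S, c ≤ M σ) (hc : 0 ≤ c) (L : ℕ) (σ : List Bool) :
    c * μ.real (𝒜.caught S L σ) ≤ M σ * μ.real (𝒜.cell σ) := by
  have hin : ∀ L σ, σ ∈ S → c * μ.real (𝒜.caught S L σ) ≤ M σ * μ.real (𝒜.cell σ) :=
    fun L σ h => mul_le_mul (hS σ h) (measureReal_mono (𝒜.caught_subset_cell S L σ))
      measureReal_nonneg (hc.trans (hS σ h))
  induction L generalizing σ with
  | zero =>
    by_cases h : σ ∈ S
    · exact hin 0 σ h
    · have h0 : 𝒜.caught S 0 σ = ∅ := by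
        ext x
        simp [Generator.caught, h]
      rw [h0, measureReal_empty, mul_zero]
      -- On a null cell the value of `M` is arbitrary and may be negative, but it is multiplied by
      -- `0`.
      rcases (measureReal_nonneg (μ := μ) (s := 𝒜.cell σ)).eq_or_lt with h1 | h1
      · rw [← h1, mul_zero]
      · exact mul_nonneg (hM.nonneg σ h1) h1.le
  | succ L ih =>
    by_cases h : σ ∈ S
    · exact hin _ σ h
    · have h0 : 𝒜.caught S (L + 1) σ =
          𝒜.caught S L (σ ++ [false]) ∪ 𝒜.caught S L (σ ++ [true]) := by
        rw [Generator.caught]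
        simp [h]
      rw [h0, ← hM.fair]
      calc _ ≤ c * (μ.real (𝒜.caught S L (σ ++ [false])) + μ.real (𝒜.caught S L (σ ++ [true]))) :=
            mul_le_mul_of_nonneg_left (measureReal_union_le _ _) hc
        _ ≤ _ := by rw [mul_add]; exact add_le_add (ih _) (ih _)

-- The sets caught from the root increase with the depth, so the finite estimate passes to the
-- limit; the root cell has measure one.
omit [BorelSpace X] in
theorem Generator.ville [IsProbabilityMeasure μ] {𝒜 : Generator a μ} {M : List Bool → ℝ}
    (hM : 𝒜.IsComputableMartingale M) {c : ℝ} {S : Set (List Bool)}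
    (hS : ∀ σ ∈ S, c ≤ M σ) (hc : 0 ≤ c) :
    ENNReal.ofReal c * μ {x | ∃ σ, σ ∈ S ∧ x ∈ 𝒜.cell σ} ≤ ENNReal.ofReal (M []) := by
  have hsub : {x | ∃ σ, σ ∈ S ∧ x ∈ 𝒜.cell σ} ⊆ ⋃ L, 𝒜.caught S L [] := by
    rintro x ⟨σ, hσ, hx⟩
    exact Set.mem_iUnion.2 ⟨σ.length, 𝒜.cell_subset_caught σ [] hσ hx⟩
  have hmono : Monotone fun L => 𝒜.caught S L [] :=
    monotone_nat_of_le_succ fun L => 𝒜.caught_subset_succ S L []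
  refine (mul_le_mul_right (measure_mono hsub) _).trans ?_
  rw [hmono.directed_le.measure_iUnion, ENNReal.mul_iSup]
  refine iSup_le fun L => ?_
  rw [← ofReal_measureReal, ← ENNReal.ofReal_mul hc]
  refine ENNReal.ofReal_le_ofReal ?_
  simpa [Generator.cell_nil] using Generator.mul_measureReal_caught_le hM hS hc L []

-- Positivity of the cell is part of the predicate because the algorithm for `M` is reliable only
-- there; it is c.e. as the instance `0 / 2 ^ 0 < μ [σ]` of lower approximability.
omit [BorelSpace X] in
theorem Generator.IsComputableMartingale.rePred_lt (hμ : IsComputableProbabilitySpace a μ)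
    {𝒜 : Generator a μ} {M : List Bool → ℝ} (hM : 𝒜.IsComputableMartingale M) {c : ℕ → ℕ}
    (hc : Computable c) :
    REPred fun q : ℕ × List Bool => q.2 ∈ 𝒜.posCells ∧ (c q.1 : ℝ) < M q.2 := by
  obtain ⟨g, hg, hgM⟩ := hM.computable
  have h1 : REPred fun q : ℕ × List Bool => q.2 ∈ 𝒜.posCells :=
    ((lowerApproximable_measure hμ (𝒜.sigma1Family_cell hμ.polish)).comp
      (f := fun q : ℕ × List Bool => (q.2, 0, 0)) (by fun_prop)).of_eq fun q => by
        simp [Generator.posCells]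
  have hg' : Partrec fun q : List Bool × ℕ => g q.1 q.2 := hg
  have h2 : REPred fun r : (ℕ × List Bool) × ℕ × ℕ => r.2.2 ∈ g r.1.2 r.2.1 :=
    (rePred_mem hg').comp
      (f := fun r : (ℕ × List Bool) × ℕ × ℕ => ((r.1.2, r.2.1), r.2.2)) (by fun_prop)
  have h3 : REPred fun r : (ℕ × List Bool) × ℕ × ℕ => c r.1.1 * 2 ^ r.2.1 + 1 < r.2.2 :=
    AlgRand.rePred_lt (by fun_prop) (by fun_prop)
  refine (h1.and (h2.and h3).exists).of_eq ?_
  rintro ⟨n, σ⟩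
  refine and_congr_right fun hσ => ?_
  simp only [Prod.exists]
  have key : ∀ k m, c n * 2 ^ k + 1 < m ↔ (c n : ℝ) + 1 / 2 ^ k < (m : ℝ) / 2 ^ k := by
    intro k m
    rw [lt_div_iff₀ (by positivity), add_mul, one_div, inv_mul_cancel₀ (by positivity)]
    exact_mod_cast Iff.rfl
  simp only [key]
  constructor
  · rintro ⟨k, m, hm, hlt⟩
    obtain ⟨m', hm', h⟩ := hgM σ hσ k
    obtain rfl := Part.mem_unique hm hm'
    have := (abs_le.1 h).1
    linarith
  · intro hlt
    obtain ⟨k, hk⟩ := exists_two_pow_inv_lt (half_pos (sub_pos.2 hlt))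
    obtain ⟨m, hm, h⟩ := hgM σ hσ k
    refine ⟨k, m, hm, ?_⟩
    have := (abs_le.1 h).2
    linarith

omit [BorelSpace X] in
theorem Generator.IsComputableMartingale.not_martinLofRandom
    (hμ : IsComputableProbabilitySpace a μ) {𝒜 : Generator a μ} {M : List Bool → ℝ}
    (hM : 𝒜.IsComputableMartingale M) {x : X} {z : ℕ → Bool} (hz : 𝒜.IsName x z)
    (h : ∀ c : ℕ, ∃ n, (c : ℝ) < M (initSeg z n)) : ¬ MartinLofRandom a μ x := by
  have := hμ.prob
  -- The test below enumerates only cells of positive measure, so points in null cells are treated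
  -- separately.
  by_cases hnull : 𝒜.InNullCell x
  · exact Generator.not_martinLofRandom_of_inNullCell hμ hnull
  obtain ⟨C, hC⟩ := exists_nat_gt (max (M []) 0)
  have hC0 : 0 < C := by exact_mod_cast (le_max_right _ _).trans_lt hC
  have hP := hM.rePred_lt hμ (c := fun n => 2 ^ n * C) (by fun_prop)
  have hU := ((𝒜.sigma1Family_cell hμ.polish).comp (f := fun q : ℕ × List Bool => q.2)
    (by fun_prop)).exists hP
  refine not_not_intro ⟨_, ⟨hU.isSigma1Seq, fun n => ?_⟩, Set.mem_iInter.2 fun n => ?_⟩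
  · refine le_two_inv_pow_of_mul_le hC0 ?_
    rw [← ENNReal.ofReal_natCast, ← ENNReal.ofReal_natCast]
    refine (Generator.ville hM (c := ((2 ^ n * C : ℕ) : ℝ))
      (S := {σ | σ ∈ 𝒜.posCells ∧ ((2 ^ n * C : ℕ) : ℝ) < M σ}) (fun σ hσ => hσ.2.le)
      (Nat.cast_nonneg _)).trans ?_
    exact ENNReal.ofReal_le_ofReal ((le_max_left _ _).trans hC.le)
  · obtain ⟨m, hm⟩ := h (2 ^ n * C)
    refine ⟨initSeg z m, ⟨?_, hm⟩, hz m⟩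
    have h0 : μ (𝒜.cell (initSeg z m)) ≠ 0 := fun h0 => hnull ⟨_, h0, hz m⟩
    exact ENNReal.toReal_pos h0 (by finiteness)

omit [BorelSpace X] in
theorem Generator.MartingaleTest.not_martinLofRandom (hμ : IsComputableProbabilitySpace a μ)
    {𝒜 : Generator a μ} {x : X} (h : 𝒜.MartingaleTest x) : ¬ MartinLofRandom a μ x := by
  obtain ⟨M, hM, z, hz, hlim⟩ := h
  refine hM.not_martinLofRandom hμ hz fun c => ?_
  by_contra! hle
  have h1 : limsup (fun n => (M (initSeg z n) : EReal)) atTop ≤ ((c : ℝ) : EReal) :=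
    limsup_le_of_le (h := Eventually.of_forall fun n => EReal.coe_le_coe_iff.2 (hle n))
  rw [hlim, top_le_iff] at h1
  exact EReal.coe_ne_top _ h1

omit [BorelSpace X] in
theorem Generator.SavingsTest.not_martinLofRandom (hμ : IsComputableProbabilitySpace a μ)
    {𝒜 : Generator a μ} {x : X} (h : 𝒜.SavingsTest x) : ¬ MartinLofRandom a μ x := by
  obtain ⟨N, -, hN, -, -, -, z, hz, hlim⟩ := h
  exact hN.not_martinLofRandom hμ hz fun c => (hlim.eventually_gt_atTop (c : ℝ)).exists

/-! ### Assembling the implications -/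

theorem MartinLofRandom.computablyRandom (hμ : IsComputableProbabilitySpace a μ) {x : X}
    (hx : MartinLofRandom a μ x) (𝒜 : Generator a μ) : 𝒜.ComputablyRandom x := by
  refine ⟨fun h => Generator.not_martinLofRandom_of_unrepresented hμ h hx,
    fun h => Generator.not_martinLofRandom_of_inNullCell hμ h hx, ?_⟩
  rintro (h | h | h | h | h)
  · exact h.not_martinLofRandom hμ hx
  · exact h.not_martinLofRandom hμ hx
  · exact h.not_martinLofRandom hx
  · exact h.not_martinLofRandom hx
  · exact h.not_martinLofRandom hμ hx

theorem Generator.ComputablyRandom.schnorrRandom (hμ : IsComputableProbabilitySpace a μ)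
    {𝒜 : Generator a μ} {x : X} (hx : 𝒜.ComputablyRandom x) : SchnorrRandom a μ x := by
  rintro ⟨U, hU, hxU⟩
  exact hx.2.2 (Or.inr (Or.inr (Or.inr (Or.inr (𝒜.vitaliCoverTest_of_schnorrTest hμ hU hxU)))))

theorem Generator.ComputablyRandom.kurtzRandom (hμ : IsComputableProbabilitySpace a μ)
    {𝒜 : Generator a μ} {x : X} (hx : 𝒜.ComputablyRandom x) : KurtzRandom a μ x := by
  rintro ⟨e, he, hxe⟩
  exact hx.2.2 (Or.inr (Or.inr (Or.inr (Or.inr (𝒜.vitaliCoverTest_of_null hμ he hxe)))))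

end MartinLof

end AlgRand

theorem mainTheorem8 {X : Type*} [MetricSpace X] [MeasurableSpace X] [BorelSpace X]
    (a : ℕ → X) (μ : MeasureTheory.Measure X) (hμ : AlgRand.IsComputableProbabilitySpace a μ)
    (x : X) :
    (AlgRand.MartinLofRandom a μ x → ∀ 𝒜 : AlgRand.Generator a μ, 𝒜.ComputablyRandom x) ∧
    (∀ 𝒜 : AlgRand.Generator a μ, 𝒜.ComputablyRandom x →
      AlgRand.SchnorrRandom a μ x ∧ AlgRand.KurtzRandom a μ x) :=
  ⟨fun hx 𝒜 => hx.computablyRandom hμ 𝒜, fun _ hx => ⟨hx.schnorrRandom hμ, hx.kurtzRandom hμ⟩⟩
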